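/- **Theorem 3.4.** Let $R$ be a commutative Noetherian ring with identity and let $n\ge 0$ be an integer. *Conventions.* A projective Noetherian $R$-algebra is an associative unital $R$-algebra that is finitely generated projective as an $R$-module; $R\text{-proj}$ denotes the finitely generated projective $R$-modules; $D=\operatorname{Hom}_R(-,R)$. For such an algebra $A$, an $(A,R)$-exact sequence is an exact sequence of $A$-modules that splits as a sequence of $R$-modules (every map $d$ satisfies $d=dsd$ for some $R$-linear $s$), and $\operatorname{add}_A M$ is the class of direct summands of finite direct sums of copies of $M$. Endomorphisms are multiplied by composition, $fg=f\circ g$. * A finitely generated right $B$-module $M$ that is projective over $R$ is an *$n$-quasi-$(B,R)$-cogenerator* if $M\otimes_B DM\in R\text{-proj}$ and $n$ is the least non-negative integer for which there is a $(B,R)$-exact sequence of right $B$-modules $0\to M_n\to\cdots\to M_0\to DB\to 0$ with all $M_i\in\operatorname{add}_B M$ that remains exact under $\operatorname{Hom}_B(M,-)$. * For a finitely generated left $A$-module $M$ that is projective over $R$, $M\text{-}\operatorname{domdim}(A,R)\ge 2$ means that there is an $(A,R)$-exact sequence $0\to A\to M_1\to M_2$ with $M_1,M_2\in\operatorname{add}_A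 M$ such that $\operatorname{Hom}_A(M_2,M)\to\operatorname{Hom}_A(M_1,M)\to\operatorname{Hom}_A(A,M)\to 0$ is exact. * For such $M$, $\operatorname{idim}_{(A,R)}M=n$ means that $n$ is the least non-negative integer such that $\operatorname{Ext}_A^{n+1}(N,M)=0$ for every finitely generated left $A$-module $N$ that is projective over $R$. Pairs consisting of an $R$-algebra and a module over it are considered up to isomorphism: $(A,M)\cong(A',M')$ if there are an $R$-algebra isomorphism $\sigma\colon A\to A'$ and an $R$-linear isomorphism $\varphi\colon M\to M'$ with $\varphi(am)=\sigma(a)\varphi(m)$ (respectively $\varphi(ma)=\varphi(m)\sigma(a)$ for right modules). Let $\varGamma$ be the class of pairs $(B,M)$ where $B$ is a projective Noetherian $R$-algebra and $M$ is an $n$-quasi-$(B,R)$-cogenerator as a right $B$-module. Let $\varLambda$ be the class of pairs $(A,M)$ where $A$ is a projective Noetherian $R$-algebra and $M$ is a finitely generated left $A$-module, projective over $R$, such that $$M\text{-}\operatorname{domdim}(A,R)\ge 2,\qquad \operatorname{idim}_{(A,R)}M=n,\qquad DM\otimes_A M\in R\text{-proj},\qquad \operatorname{Tor}^A_i(DM,M)=0\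 \text{ for all } i>0.$$ Then the assignments $$\varPhi\colon\varGamma\to\varLambda,\ (B,M)\mapsto(\operatorname{End}_B(M),M),\qquad \varPsi\colon\varLambda\to\varGamma,\ (A,M)\mapsto(\operatorname{End}_A(M)^{op},M)$$ are well defined and induce mutually inverse bijections between the isomorphism classes of pairs in $\varGamma$ and those in $\varLambda$. -/

import Mathlib

open CategoryTheory TensorProduct MulOpposite

universe u

namespace HigherMorita

/-! Conventions: a right module over `C` is a left module over `Cᵐᵒᵖ`.  The modules over an
`R`-algebra `C` carry the `R`-module structure induced by `C` (`IsScalarTower R C M`). -/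

/-- `X ∈ R-proj`: a finitely generated projective `R`-module. -/
def IsRProj (R : Type u) [CommRing R] (X : Type u) [AddCommGroup X] [Module R X] : Prop :=
  Module.Finite R X ∧ Module.Projective R X

/-- A projective Noetherian `R`-algebra (over a Noetherian `R`): an `R`-algebra which is finitely
generated projective as an `R`-module. -/
def IsProjNoethAlg (R : Type u) [CommRing R] (A : Type u) [Ring A] [Algebra R A] : Prop :=
  IsRProj R A

section Dual

/-- The standard dual `D M = Hom_R(M, R)`. -/
def StdDual (R : Type u) [CommRing R] (M : Type u) [AddCommGroup M] [Module R M] : Type u :=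
  M →ₗ[R] R

variable (R : Type u) [CommRing R] (M : Type u) [AddCommGroup M] [Module R M]

instance : AddCommGroup (StdDual R M) := inferInstanceAs (AddCommGroup (M →ₗ[R] R))

instance : Module R (StdDual R M) := inferInstanceAs (Module R (M →ₗ[R] R))

instance : FunLike (StdDual R M) M R := inferInstanceAs (FunLike (M →ₗ[R] R) M R)

instance : LinearMapClass (StdDual R M) R M R :=
  inferInstanceAs (LinearMapClass (M →ₗ[R] R) R M R)

/-- Multiplication by `c`, as an `R`-linear endomorphism of a `C`-module. -/
def smulEnd (C : Type u) [Ring C] [Algebra R C] [Module C M] [IsScalarTower R C M] (c : C) :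
    M →ₗ[R] M where
  toFun m := c • m
  map_add' := smul_add c
  map_smul' r m := smul_comm c r m

variable {R M}

/-- If `M` is a left `C`-module, then `D M` is a right `C`-module via `(f · c)(m) = f (c m)`. -/
instance instModuleStdDualRight {C : Type u} [Ring C] [Algebra R C] [Module C M]
    [IsScalarTower R C M] : Module Cᵐᵒᵖ (StdDual R M) where
  smul c f := LinearMap.comp (f : M →ₗ[R] R) (smulEnd R M C (unop c))
  one_smul f := LinearMap.ext fun m => congrArg (f : M →ₗ[R] R) (one_smul C m)
  mul_smul a b f := LinearMap.ext fun m =>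
    congrArg (f : M →ₗ[R] R) (mul_smul (unop b) (unop a) m)
  smul_zero _ := LinearMap.zero_comp _
  smul_add _ _ _ := LinearMap.add_comp _ _ _
  add_smul a b f := LinearMap.ext fun m =>
    (congrArg (f : M →ₗ[R] R) (add_smul (unop a) (unop b) m)).trans
      (map_add (f : M →ₗ[R] R) _ _)
  zero_smul f := LinearMap.ext fun m =>
    (congrArg (f : M →ₗ[R] R) (zero_smul C m)).trans (map_zero (f : M →ₗ[R] R))

theorem op_smul_apply {C : Type u} [Ring C] [Algebra R C] [Module C M] [IsScalarTower R C M]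
    (c : C) (f : StdDual R M) (m : M) : (op c • f) m = f (c • m) := rfl

instance {C : Type u} [Ring C] [Algebra R C] [Module C M] [IsScalarTower R C M] :
    IsScalarTower R Cᵐᵒᵖ (StdDual R M) where
  smul_assoc r c f := LinearMap.ext fun m =>
    (congrArg (f : M →ₗ[R] R) (smul_assoc r (unop c) m)).trans
      (map_smul (f : M →ₗ[R] R) r _)

/-- If `M` is a right `C`-module, then `D M` is a left `C`-module via `(c f)(m) = f (m c)`. -/
instance (priority := low) instModuleStdDualLeft {C : Type u} [Ring C] [Algebra R C]
    [Module Cᵐᵒᵖ M] [IsScalarTower R Cᵐᵒᵖ M] : Module C (StdDual R M) where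
  smul c f := LinearMap.comp (f : M →ₗ[R] R) (smulEnd R M Cᵐᵒᵖ (op c))
  one_smul f := LinearMap.ext fun m => congrArg (f : M →ₗ[R] R) (one_smul Cᵐᵒᵖ m)
  mul_smul a b f := LinearMap.ext fun m =>
    congrArg (f : M →ₗ[R] R) (mul_smul (op b) (op a) m)
  smul_zero _ := LinearMap.zero_comp _
  smul_add _ _ _ := LinearMap.add_comp _ _ _
  add_smul a b f := LinearMap.ext fun m =>
    (congrArg (f : M →ₗ[R] R) (add_smul (op a) (op b) m)).trans
      (map_add (f : M →ₗ[R] R) _ _)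
  zero_smul f := LinearMap.ext fun m =>
    (congrArg (f : M →ₗ[R] R) (zero_smul Cᵐᵒᵖ m)).trans (map_zero (f : M →ₗ[R] R))

theorem smul_apply {C : Type u} [Ring C] [Algebra R C] [Module Cᵐᵒᵖ M] [IsScalarTower R Cᵐᵒᵖ M]
    (c : C) (f : StdDual R M) (m : M) : (c • f) m = f (op c • m) := rfl

end Dual

section Tensor

variable (R : Type u) [CommRing R] (A : Type u) [Ring A]
  (N : Type u) [AddCommGroup N] [Module R N] [Module Aᵐᵒᵖ N]

/-- The relations `n a ⊗ x = n ⊗ a x`. -/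
def tensorRel (X : Type u) [AddCommGroup X] [Module A X] : Submodule R (N ⊗[ℤ] X) :=
  Submodule.span R {t | ∃ (n : N) (a : A) (x : X), t = (op a • n) ⊗ₜ[ℤ] x - n ⊗ₜ[ℤ] (a • x)}

/-- `N ⊗_A X` for a right `A`-module `N` and a left `A`-module `X` (the ring `A` need not be
commutative), with the `R`-module structure induced by `N`.  In all uses `N` is a module over an
`R`-algebra `A` and its `R`-structure is the one induced by `A`. -/
abbrev TensorOver (X : Type u) [AddCommGroup X] [Module A X] : Type u :=
  (N ⊗[ℤ] X) ⧸ tensorRel R A N X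

/-- `id_N ⊗ f`, before passing to the quotient. -/
def preTensorMap {X Y : Type u} [AddCommGroup X] [Module A X] [AddCommGroup Y] [Module A Y]
    (f : X →ₗ[A] Y) : N ⊗[ℤ] X →ₗ[R] N ⊗[ℤ] Y :=
  TensorProduct.AlgebraTensorModule.map LinearMap.id f.toAddMonoidHom.toIntLinearMap

/-- `N ⊗_A f : N ⊗_A X → N ⊗_A Y`. -/
def tensorMap {X Y : Type u} [AddCommGroup X] [Module A X] [AddCommGroup Y] [Module A Y]
    (f : X →ₗ[A] Y) : TensorOver R A N X →ₗ[R] TensorOver R A N Y :=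
  Submodule.mapQ _ _ (preTensorMap R A N f) (by
    refine Submodule.span_le.2 ?_
    rintro _ ⟨n, a, x, rfl⟩
    refine Submodule.subset_span ⟨n, a, f x, ?_⟩
    simp [preTensorMap])

theorem tensorMap_id (X : Type u) [AddCommGroup X] [Module A X] :
    tensorMap R A N (LinearMap.id : X →ₗ[A] X) = LinearMap.id := by
  refine Submodule.linearMap_qext _ (LinearMap.ext fun t => ?_)
  induction t with
  | zero => simp only [map_zero]
  | add x y hx hy => simp only [map_add, hx, hy]
  | tmul n x => rfl

theorem tensorMap_comp {X Y Z : Type u} [AddCommGroup X] [Module A X] [AddCommGroup Y]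
    [Module A Y] [AddCommGroup Z] [Module A Z] (f : X →ₗ[A] Y) (g : Y →ₗ[A] Z) :
    tensorMap R A N (g ∘ₗ f) = tensorMap R A N g ∘ₗ tensorMap R A N f := by
  refine Submodule.linearMap_qext _ (LinearMap.ext fun t => ?_)
  induction t with
  | zero => simp only [map_zero]
  | add x y hx hy => simp only [map_add, hx, hy]
  | tmul n x => rfl

theorem tensorMap_add {X Y : Type u} [AddCommGroup X] [Module A X] [AddCommGroup Y]
    [Module A Y] (f g : X →ₗ[A] Y) :
    tensorMap R A N (f + g) = tensorMap R A N f + tensorMap R A N g := by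
  refine Submodule.linearMap_qext _ (LinearMap.ext fun t => ?_)
  induction t with
  | zero => simp only [map_zero]
  | add x y hx hy => simp only [map_add, hx, hy]
  | tmul n x =>
    exact congrArg (Submodule.Quotient.mk (p := tensorRel R A N Y))
      (TensorProduct.tmul_add n (f x) (g x))

/-- The functor `N ⊗_A - : A-Mod ⥤ R-Mod`. -/
def tensorFunctor : ModuleCat.{u} A ⥤ ModuleCat.{u} R where
  obj X := ModuleCat.of R (TensorOver R A N X)
  map f := ModuleCat.ofHom (tensorMap R A N f.hom)
  map_id X := ModuleCat.hom_ext (tensorMap_id R A N X)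
  map_comp f g := ModuleCat.hom_ext (tensorMap_comp R A N f.hom g.hom)

instance : (tensorFunctor R A N).Additive where
  map_add {_ _ f g} := ModuleCat.hom_ext (tensorMap_add R A N f.hom g.hom)

/-- `Tor_i^A(N, X)`: the `i`-th left derived functor of `N ⊗_A -` at `X`. -/
noncomputable def TorOver (i : ℕ) (X : Type u) [AddCommGroup X] [Module A X] : ModuleCat.{u} R :=
  ((tensorFunctor R A N).leftDerived i).obj (ModuleCat.of A X)

end Tensor

section Sequences

/-- A left module over the `R`-algebra `C`. -/
structure AlgMod (R : Type u) [CommRing R] (C : Type u) [Ring C] [Algebra R C] where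
  /-- the underlying type -/
  carrier : Type u
  [addCommGroup : AddCommGroup carrier]
  [moduleBase : Module R carrier]
  [module : Module C carrier]
  [isScalarTower : IsScalarTower R C carrier]

attribute [instance] AlgMod.addCommGroup AlgMod.moduleBase AlgMod.module AlgMod.isScalarTower

instance (R : Type u) [CommRing R] (C : Type u) [Ring C] [Algebra R C] :
    CoeSort (AlgMod R C) (Type u) := ⟨AlgMod.carrier⟩

variable (R : Type u) [CommRing R] {C : Type u} [Ring C] [Algebra R C]

/-- `f` is split as a map of `R`-modules: `f s f = f` for some `R`-linear `s`, equivalently the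
kernel and the image of `f` are direct summands over `R`.  An exact sequence splits as a sequence
of `R`-modules if and only if all its maps are split in this sense. -/
def IsSplitOver {X Y : Type u} [AddCommGroup X] [Module R X] [Module C X]
    [AddCommGroup Y] [Module R Y] [Module C Y] (f : X →ₗ[C] Y) : Prop :=
  ∃ s : Y →ₗ[R] X, ∀ x, f (s (f x)) = f x

variable (C) in
/-- `X ∈ add_C M`: `X` is a direct summand of a finite direct sum of copies of `M`. -/
def InAdd (M X : Type u) [AddCommGroup M] [Module C M] [AddCommGroup X] [Module C X] : Prop :=
  ∃ (k : ℕ) (i : X →ₗ[C] (Fin k → M)) (p : (Fin k → M) →ₗ[C] X), p ∘ₗ i = LinearMap.id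

/-- `Hom_C(f, Q) : Hom_C(Y, Q) → Hom_C(X, Q)`. -/
def homInto (Q : Type u) [AddCommGroup Q] [Module C Q] {X Y : Type u} [AddCommGroup X]
    [Module C X] [AddCommGroup Y] [Module C Y] (f : X →ₗ[C] Y) (g : Y →ₗ[C] Q) : X →ₗ[C] Q :=
  g ∘ₗ f

/-- `Hom_C(Q, f) : Hom_C(Q, X) → Hom_C(Q, Y)`. -/
def homFrom (Q : Type u) [AddCommGroup Q] [Module C Q] {X Y : Type u} [AddCommGroup X]
    [Module C X] [AddCommGroup Y] [Module C Y] (f : X →ₗ[C] Y) (g : Q →ₗ[C] X) : Q →ₗ[C] Y :=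
  f ∘ₗ g

variable (C)

/-- `Q-domdim_{(C, R)} M ≥ n`: there is a `(C, R)`-exact sequence `0 → M → Q₁ → ⋯ → Qₙ` with
all `Qᵢ ∈ add_C Q` which remains exact under `Hom_C(-, Q)`.  Here `X 0 ≅ M` and `X i = Qᵢ` for
`1 ≤ i ≤ n`; the terms `X i` with `i > n` and the maps `d i` with `i ≥ n` are irrelevant. -/
def DomDimGE (Q M : Type u) [AddCommGroup Q] [Module C Q] [AddCommGroup M] [Module C M]
    (n : ℕ) : Prop :=
  ∃ (X : ℕ → AlgMod R C) (d : ∀ i, X i →ₗ[C] X (i + 1)),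
    Nonempty (X 0 ≃ₗ[C] M) ∧
    (∀ i, 1 ≤ i → i ≤ n → InAdd C Q (X i)) ∧
    -- exactness
    (1 ≤ n → Function.Injective (d 0)) ∧
    (∀ i, i + 2 ≤ n → Function.Exact (d i) (d (i + 1))) ∧
    -- splitting over `R`
    (∀ i, i + 1 ≤ n → IsSplitOver R (d i)) ∧
    -- exactness of `Hom(Qₙ, Q) → ⋯ → Hom(Q₁, Q) → Hom(M, Q) → 0`
    (1 ≤ n → Function.Surjective (homInto Q (d 0))) ∧
    (∀ i, i + 2 ≤ n → Function.Exact (homInto Q (d (i + 1))) (homInto Q (d i)))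

/-- There is a `(C, R)`-exact sequence `0 → Mₙ → ⋯ → M₀ → N → 0` with all `Mᵢ ∈ add_C M` which
remains exact under `Hom_C(M, -)`.  Here `X 0 ≅ N`, `X (i + 1) = Mᵢ` for `i ≤ n`, and `X i = 0`
for `i ≥ n + 2`. -/
def HasAddResolution (M N : Type u) [AddCommGroup M] [Module C M] [AddCommGroup N] [Module C N]
    (n : ℕ) : Prop :=
  ∃ (X : ℕ → AlgMod R C) (d : ∀ i, X (i + 1) →ₗ[C] X i),
    Nonempty (X 0 ≃ₗ[C] N) ∧
    (∀ i, i ≤ n → InAdd C M (X (i + 1))) ∧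
    (∀ i, n + 2 ≤ i → Subsingleton (X i)) ∧
    -- exactness
    Function.Surjective (d 0) ∧
    (∀ i, Function.Exact (d (i + 1)) (d i)) ∧
    -- splitting over `R`
    (∀ i, IsSplitOver R (d i)) ∧
    -- exactness of `0 → Hom(M, Mₙ) → ⋯ → Hom(M, M₀) → Hom(M, N) → 0`
    Function.Surjective (homFrom M (d 0)) ∧
    (∀ i, Function.Exact (homFrom M (d (i + 1))) (homFrom M (d i)))

/-- `idim_{(C, R)} M ≤ n`: `Ext_C^{n+1}(N, M) = 0` for all finitely generated `C`-modules `N`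
which are projective over `R`. -/
def RelInjDimLE (M : Type u) [AddCommGroup M] [Module C M] (n : ℕ) : Prop :=
  ∀ N : AlgMod R C, Module.Finite C N → Module.Projective R N →
    Subsingleton (Abelian.Ext (ModuleCat.of C N) (ModuleCat.of C M) (n + 1))

/-- `idim_{(C, R)} M = n`. -/
def RelInjDimEq (M : Type u) [AddCommGroup M] [Module C M] (n : ℕ) : Prop :=
  IsLeast {k | RelInjDimLE R C M k} n

end Sequences

section Pairs

/-- The right `B`-module `M` is an `n`-quasi-`(B, R)`-cogenerator. -/
def IsQuasiCogenerator (R : Type u) [CommRing R] (B : Type u) [Ring B] [Algebra R B]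
    (M : Type u) [AddCommGroup M] [Module R M] [Module Bᵐᵒᵖ M] [IsScalarTower R Bᵐᵒᵖ M]
    (n : ℕ) : Prop :=
  Module.Finite Bᵐᵒᵖ M ∧ Module.Projective R M ∧
  IsRProj R (TensorOver R B M (StdDual R M)) ∧
  IsLeast {k | HasAddResolution R Bᵐᵒᵖ M (StdDual R B) k} n

/-- A pair `(B, M)` of an `R`-algebra `B` and a right `B`-module `M`. -/
structure RightPair (R : Type u) [CommRing R] where
  /-- the algebra -/
  alg : Type u
  /-- the right module -/
  mod : Type u
  [ring : Ring alg]
  [algebra : Algebra R alg]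
  [addCommGroup : AddCommGroup mod]
  [moduleBase : Module R mod]
  [module : Module algᵐᵒᵖ mod]
  [isScalarTower : IsScalarTower R algᵐᵒᵖ mod]

attribute [instance] RightPair.ring RightPair.algebra RightPair.addCommGroup RightPair.moduleBase
  RightPair.module RightPair.isScalarTower

/-- A pair `(A, M)` of an `R`-algebra `A` and a left `A`-module `M`. -/
structure LeftPair (R : Type u) [CommRing R] where
  /-- the algebra -/
  alg : Type u
  /-- the left module -/
  mod : Type u
  [ring : Ring alg]
  [algebra : Algebra R alg]
  [addCommGroup : AddCommGroup mod]
  [moduleBase : Module R mod]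
  [module : Module alg mod]
  [isScalarTower : IsScalarTower R alg mod]

attribute [instance] LeftPair.ring LeftPair.algebra LeftPair.addCommGroup LeftPair.moduleBase
  LeftPair.module LeftPair.isScalarTower

variable {R : Type u} [CommRing R]

/-- An isomorphism `(B, M) ≅ (B', M')`: an `R`-algebra isomorphism `σ : B ≅ B'` with an
isomorphism `φ : M ≅ M'` satisfying `φ (m b) = φ (m) σ (b)`. -/
def RightPair.Iso (P P' : RightPair R) : Prop :=
  ∃ (σ : P.alg ≃ₐ[R] P'.alg) (φ : P.mod ≃ₗ[R] P'.mod),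
    ∀ (b : P.alg) (m : P.mod), φ (op b • m) = op (σ b) • φ m

/-- An isomorphism `(A, M) ≅ (A', M')`: an `R`-algebra isomorphism `σ : A ≅ A'` with an
isomorphism `φ : M ≅ M'` satisfying `φ (a m) = σ (a) φ (m)`. -/
def LeftPair.Iso (P P' : LeftPair R) : Prop :=
  ∃ (σ : P.alg ≃ₐ[R] P'.alg) (φ : P.mod ≃ₗ[R] P'.mod),
    ∀ (a : P.alg) (m : P.mod), φ (a • m) = σ a • φ m

theorem RightPair.iso_equivalence : Equivalence (RightPair.Iso (R := R)) where
  refl _ := ⟨AlgEquiv.refl, LinearEquiv.refl R _, fun _ _ => rfl⟩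
  symm := by
    rintro _ _ ⟨σ, φ, h⟩
    refine ⟨σ.symm, φ.symm, fun b m => φ.injective ?_⟩
    rw [h]
    simp
  trans := by
    rintro _ _ _ ⟨σ, φ, h⟩ ⟨τ, ψ, k⟩
    refine ⟨σ.trans τ, φ.trans ψ, fun b m => ?_⟩
    simp [h, k]

theorem LeftPair.iso_equivalence : Equivalence (LeftPair.Iso (R := R)) where
  refl _ := ⟨AlgEquiv.refl, LinearEquiv.refl R _, fun _ _ => rfl⟩
  symm := by
    rintro _ _ ⟨σ, φ, h⟩
    refine ⟨σ.symm, φ.symm, fun b m => φ.injective ?_⟩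
    rw [h]
    simp
  trans := by
    rintro _ _ _ ⟨σ, φ, h⟩ ⟨τ, ψ, k⟩
    refine ⟨σ.trans τ, φ.trans ψ, fun b m => ?_⟩
    simp [h, k]

/-- `(B, M) ↦ (End_B(M), M)`, where the product `f g` in `End_B(M)` is `f ∘ g`. -/
def RightPair.endo (P : RightPair R) : LeftPair R where
  alg := Module.End P.algᵐᵒᵖ P.mod
  mod := P.mod

/-- A left `E`-module is a right `Eᵐᵒᵖ`-module via `m · op e = e m`. -/
abbrev opOpModule (E : Type u) [Ring E] (M : Type u) [AddCommGroup M] [Module E M] :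
    Module Eᵐᵒᵖᵐᵒᵖ M :=
  Module.compHom M (RingEquiv.opOp E).symm.toRingHom

/-- `(A, M) ↦ (End_A(M)ᵒᵖ, M)`. -/
def LeftPair.endoOp (P : LeftPair R) : RightPair R :=
  letI := opOpModule (Module.End P.alg P.mod) P.mod
  haveI : IsScalarTower R (Module.End P.alg P.mod)ᵐᵒᵖᵐᵒᵖ P.mod :=
    ⟨fun _ _ _ => rfl⟩
  { alg := (Module.End P.alg P.mod)ᵐᵒᵖ
    mod := P.mod }

variable (R)

/-- The class of pairs `(B, M)` with `B` a projective Noetherian `R`-algebra and `M` an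
`n`-quasi-`(B, R)`-cogenerator as a right `B`-module. -/
def CogenClass (n : ℕ) : Set (RightPair R) :=
  {P | IsProjNoethAlg R P.alg ∧ IsQuasiCogenerator R P.alg P.mod n}

/-- The class of pairs `(A, M)` with `A` a projective Noetherian `R`-algebra and
`M ∈ A-mod ∩ R-proj` such that `M-domdim (A, R) ≥ 2`, `idim_{(A, R)} M = n`,
`DM ⊗_A M ∈ R-proj` and `Tor_i^A(DM, M) = 0` for all `i > 0`. -/
def DomClass (n : ℕ) : Set (LeftPair R) :=
  {P | IsProjNoethAlg R P.alg ∧ Module.Finite P.alg P.mod ∧ Module.Projective R P.mod ∧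
    DomDimGE R P.alg P.mod P.alg 2 ∧
    RelInjDimEq R P.alg P.mod n ∧
    IsRProj R (TensorOver R P.alg (StdDual R P.mod) P.mod) ∧
    ∀ i : ℕ, 0 < i → Limits.IsZero (TorOver R P.alg (StdDual R P.mod) i P.mod)}

/-- Isomorphism of pairs in the first class. -/
def cogenSetoid (n : ℕ) : Setoid (CogenClass R n) :=
  Setoid.comap Subtype.val ⟨RightPair.Iso, RightPair.iso_equivalence⟩

/-- Isomorphism of pairs in the second class. -/
def domSetoid (n : ℕ) : Setoid (DomClass R n) :=
  Setoid.comap Subtype.val ⟨LeftPair.Iso, LeftPair.iso_equivalence⟩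

end Pairs

end HigherMorita

/-!
Let `A` and `B` act on `M` from the left and from the right, with everything finitely generated
projective over `R`. The theorem rests on the two natural maps
`M ⊗_B D M → D A`, `m ⊗ f ↦ f(- m)`, and `D M ⊗_A M → D B`, `f ⊗ m ↦ f(m -)`.
As `D(M ⊗_B D M) = End_B(M)` and `D(D M ⊗_A M) = End_A(M)`, reflexivity shows that, when source and
target are finitely generated projective over `R`, these maps are bijective exactly when `A` is the
full endomorphism ring of `M` over `B`, respectively `Bᵒᵖ` that of `M` over `A`
(`flip_leftTrace_bijective_iff`, `flip_rightTrace_bijective_iff`). Once both maps are bijective, the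
pairs `(A, M)` and `(B, M)` determine each other, and it remains to match the other conditions.

* Dominant dimension. A free presentation `Bˡ → Bᵏ → M → 0` gives an exact sequence `0 → A → Mᵏ → Mˡ`
  upon applying `Hom_B(-, M)`. Its `R`-dual is obtained from the presentation by applying
  `- ⊗_B D M`, hence is right exact with cokernel `M ⊗_B D M ≅ D A`, so that the sequence splits
  over `R` (`domDimGE_two`). Conversely a sequence `0 → A → M₁ → M₂` as in the definition of the
  dominant dimension provides an inverse of `M ⊗_B D M → D A` (`leftTrace_bijective`).
* Injective dimension. The `R`-dual of a projective resolution of the right `A`-module `D M` is a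
  resolution of `M` by relative injectives, because `Ext^i(N, D Q) = 0` for `i > 0`, `Q` projective
  and `N` projective over `R`. Dimension shifting therefore identifies the relative injective
  dimension of `M` with the projective dimension of `D M` (`relInjDimLE_iff`).
* Resolutions. The functors `Hom_B(M, -)` and `- ⊗_A M` are inverse equivalences between `add_B M`
  and the finitely generated projective right `A`-modules, and exchange `D B` and `D M`. A resolution
  of `D B` in `add_B M` that stays exact under `Hom_B(M, -)` becomes a projective resolution of `D M`
  that stays exact under `- ⊗_A M`, which is the vanishing of `Tor^A_i(D M, M)` for `i > 0`
  (`BalancedPairing.projRes_of_addRes`); the way back is `BalancedPairing.addRes_of_projRes`.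

`Tor` is defined by resolving the left module `M`, whereas here it is `D M` that is resolved; the two
are compared by a diagram chase for `Tor₁` (`TensorOver.injective_iff_of_exact`) and dimension
shifting.
-/

namespace HigherMorita

/-! ### Duals of finitely generated projective modules -/

section RProj

variable {R : Type u} [CommRing R]

theorem IsRProj.of_retract {X Y : Type u} [AddCommGroup X] [Module R X] [AddCommGroup Y]
    [Module R Y] (h : IsRProj R X) (i : Y →ₗ[R] X) (p : X →ₗ[R] Y) (hpi : ∀ y, p (i y) = y) :
    IsRProj R Y := by
  obtain ⟨_, _⟩ := h
  exact ⟨Module.Finite.of_surjective p fun y => ⟨i y, hpi y⟩,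
    Module.Projective.of_split i p (LinearMap.ext hpi)⟩

theorem IsRProj.of_equiv {X Y : Type u} [AddCommGroup X] [Module R X] [AddCommGroup Y]
    [Module R Y] (h : IsRProj R X) (e : X ≃ₗ[R] Y) : IsRProj R Y :=
  h.of_retract e.symm.toLinearMap e.toLinearMap fun y => e.apply_symm_apply y

theorem IsRProj.pi {X : Type u} [AddCommGroup X] [Module R X] (h : IsRProj R X) (k : ℕ) :
    IsRProj R (Fin k → X) := by
  obtain ⟨_, _⟩ := h
  exact ⟨inferInstance,
    Module.Projective.of_equiv (DFinsupp.linearEquivFunOnFintype (R := R) (M := fun _ : Fin k => X))⟩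

theorem IsRProj.stdDual {X : Type u} [AddCommGroup X] [Module R X] (h : IsRProj R X) :
    IsRProj R (StdDual R X) := by
  obtain ⟨_, _⟩ := h
  exact ⟨inferInstanceAs (Module.Finite R (Module.Dual R X)),
    inferInstanceAs (Module.Projective R (Module.Dual R X))⟩

/-- A surjection onto a finitely generated projective module has a section. -/
theorem IsRProj.exists_section {X Y : Type u} [AddCommGroup X] [Module R X] [AddCommGroup Y]
    [Module R Y] (h : IsRProj R Y) (p : X →ₗ[R] Y) (hp : Function.Surjective p) :
    ∃ s : Y →ₗ[R] X, ∀ y, p (s y) = y := by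
  obtain ⟨_, _⟩ := h
  obtain ⟨s, hs⟩ := Module.projective_lifting_property p LinearMap.id hp
  exact ⟨s, fun y => LinearMap.congr_fun hs y⟩

variable {C : Type u} [Ring C] [Algebra R C] {X Y : Type u}
  [AddCommGroup X] [Module R X] [Module C X] [IsScalarTower R C X]
  [AddCommGroup Y] [Module R Y] [Module C Y] [IsScalarTower R C Y]

theorem IsRProj.isSplitOver (h : IsRProj R Y) {p : X →ₗ[C] Y} (hp : Function.Surjective p) :
    IsSplitOver R p := by
  obtain ⟨s, hs⟩ := h.exists_section (p.restrictScalars R) hp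
  exact ⟨s, fun x => hs (p x)⟩

theorem IsSplitOver.exists_retraction {p : X →ₗ[C] Y} (hp : IsSplitOver R p) :
    ∃ r : X →ₗ[R] LinearMap.ker p, ∀ x : LinearMap.ker p, r x = x := by
  obtain ⟨t, ht⟩ := hp
  let r : X →ₗ[R] LinearMap.ker p :=
    LinearMap.codRestrict ((LinearMap.ker p).restrictScalars R)
      (LinearMap.id - t ∘ₗ p.restrictScalars R) fun x => by simp [ht]
  refine ⟨r, fun x => Subtype.ext ?_⟩
  have : p x = 0 := x.2
  change (x : X) - t (p x) = x
  rw [this, map_zero, sub_zero]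

theorem IsRProj.ker (h : IsRProj R X) {p : X →ₗ[C] Y} (hp : IsSplitOver R p) :
    IsRProj R (LinearMap.ker p) := by
  obtain ⟨r, hr⟩ := hp.exists_retraction
  exact h.of_retract ((LinearMap.ker p).subtype.restrictScalars R) r hr

end RProj

section StdDual

variable {R : Type u} [CommRing R]

namespace StdDual

variable {M : Type u} [AddCommGroup M] [Module R M]

@[ext] theorem ext {f g : StdDual R M} (h : ∀ m, f m = g m) : f = g := DFunLike.ext f g h

@[simp] theorem add_apply (f g : StdDual R M) (m : M) : (f + g) m = f m + g m := rfl
@[simp] theorem zero_apply (m : M) : (0 : StdDual R M) m = 0 := rfl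
@[simp] theorem base_smul_apply (r : R) (f : StdDual R M) (m : M) : (r • f) m = r • f m := rfl

@[simp] theorem sum_apply {ι : Type*} (s : Finset ι) (f : ι → StdDual R M) (m : M) :
    (∑ i ∈ s, f i) m = ∑ i ∈ s, f i m :=
  LinearMap.sum_apply s (fun i => (f i : M →ₗ[R] R)) m

/-- A linear functional, regarded as an element of `D M`. -/
def of (f : M →ₗ[R] R) : StdDual R M := f

@[simp] theorem of_apply (f : M →ₗ[R] R) (m : M) : of f m = f m := rfl

/-- The underlying linear functional of an element of `D M`. -/
def toLin (f : StdDual R M) : M →ₗ[R] R := f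

@[simp] theorem toLin_apply (f : StdDual R M) (m : M) : f.toLin m = f m := rfl

theorem map_sum' {ι : Type*} (s : Finset ι) (f : StdDual R M) (m : ι → M) :
    f (∑ i ∈ s, m i) = ∑ i ∈ s, f (m i) := map_sum f.toLin m s

/-- A finitely generated projective module is torsionless. -/
theorem eq_of_forall (h : IsRProj R M) {x y : M} (hxy : ∀ f : StdDual R M, f x = f y) : x = y := by
  obtain ⟨_, _⟩ := h
  exact (Module.bijective_dual_eval R M).1 (LinearMap.ext fun f => hxy f)

/-- A finitely generated projective module is reflexive. -/
theorem exists_eval (h : IsRProj R M) (F : StdDual R M →ₗ[R] R) :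
    ∃ x : M, ∀ f : StdDual R M, F f = f x := by
  obtain ⟨_, _⟩ := h
  obtain ⟨x, hx⟩ := (Module.bijective_dual_eval R M).2 F
  exact ⟨x, fun f => (LinearMap.congr_fun hx f).symm⟩

end StdDual

variable {C : Type u} [Ring C] [Algebra R C]

section Left

variable {X Y Z : Type u}
  [AddCommGroup X] [Module R X] [Module C X] [IsScalarTower R C X]
  [AddCommGroup Y] [Module R Y] [Module C Y] [IsScalarTower R C Y]
  [AddCommGroup Z] [Module R Z] [Module C Z] [IsScalarTower R C Z]

/-- The transpose `D Y → D X` of a map `X → Y` of left `C`-modules, a map of right modules. -/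
def transposeLeft (f : X →ₗ[C] Y) : StdDual R Y →ₗ[Cᵐᵒᵖ] StdDual R X where
  toFun g := StdDual.of (g.toLin ∘ₗ f.restrictScalars R)
  map_add' _ _ := rfl
  map_smul' c g := StdDual.ext fun x => by
    induction c with | _ c => exact congrArg g (f.map_smul c x).symm

@[simp] theorem transposeLeft_apply (f : X →ₗ[C] Y) (g : StdDual R Y) (x : X) :
    transposeLeft f g x = g (f x) := rfl

end Left

section Right

variable {X Y Z : Type u}
  [AddCommGroup X] [Module R X] [Module Cᵐᵒᵖ X] [IsScalarTower R Cᵐᵒᵖ X]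
  [AddCommGroup Y] [Module R Y] [Module Cᵐᵒᵖ Y] [IsScalarTower R Cᵐᵒᵖ Y]

/-- The transpose `D Y → D X` of a map `X → Y` of right `C`-modules, a map of left modules. -/
def transposeRight (f : X →ₗ[Cᵐᵒᵖ] Y) : StdDual R Y →ₗ[C] StdDual R X where
  toFun g := StdDual.of (g.toLin ∘ₗ f.restrictScalars R)
  map_add' _ _ := rfl
  map_smul' c g := StdDual.ext fun x => congrArg g (f.map_smul (op c) x).symm

@[simp] theorem transposeRight_apply (f : X →ₗ[Cᵐᵒᵖ] Y) (g : StdDual R Y) (x : X) :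
    transposeRight f g x = g (f x) := rfl

end Right

instance {M : Type u} [AddCommGroup M] [Module R M] [Module Cᵐᵒᵖ M] [IsScalarTower R Cᵐᵒᵖ M] :
    IsScalarTower R C (StdDual R M) where
  smul_assoc r c f := StdDual.ext fun m => by
    rw [smul_apply, StdDual.base_smul_apply, smul_apply, ← map_smul, op_smul, smul_assoc]

/-- Evaluation `M → D D M` for a left `C`-module `M`. -/
def evalHom (M : Type u) [AddCommGroup M] [Module R M] [Module C M]
    [IsScalarTower R C M] : M →ₗ[C] StdDual R (StdDual R M) where
  toFun m := StdDual.of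
    { toFun f := f m
      map_add' _ _ := rfl
      map_smul' _ _ := rfl }
  map_add' x y := StdDual.ext fun f => map_add f x y
  map_smul' _ _ := rfl

/-- The isomorphism `M ≅ D D M` of a left `C`-module which is finitely generated projective over
`R` with its double dual. -/
noncomputable def evalEquiv {M : Type u} [AddCommGroup M] [Module R M] [Module C M]
    [IsScalarTower R C M] (h : IsRProj R M) : M ≃ₗ[C] StdDual R (StdDual R M) :=
  LinearEquiv.ofBijective (evalHom M)
    ⟨fun x y hxy => StdDual.eq_of_forall h fun f => DFunLike.congr_fun hxy f, fun F => by
      obtain ⟨x, hx⟩ := StdDual.exists_eval h F.toLin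
      exact ⟨x, StdDual.ext fun f => (hx f).symm⟩⟩

@[simp] theorem evalEquiv_apply {M : Type u} [AddCommGroup M] [Module R M] [Module C M]
    [IsScalarTower R C M] (h : IsRProj R M) (m : M) (f : StdDual R M) :
    evalEquiv (C := C) h m f = f m := rfl

end StdDual

section Add

variable {C : Type u} [Ring C]

theorem InAdd.congr {M X Y : Type u} [AddCommGroup M] [Module C M] [AddCommGroup X] [Module C X]
    [AddCommGroup Y] [Module C Y] (h : InAdd C M X) (e : X ≃ₗ[C] Y) : InAdd C M Y := by
  obtain ⟨k, i, p, hpi⟩ := h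
  refine ⟨k, i ∘ₗ e.symm.toLinearMap, e.toLinearMap ∘ₗ p, LinearMap.ext fun y => ?_⟩
  exact (congrArg e (LinearMap.congr_fun hpi (e.symm y))).trans (e.apply_symm_apply y)

/-- A module lies in `add M` if and only if its identity is a finite sum of maps factoring
through `M`. -/
theorem inAdd_iff {M X : Type u} [AddCommGroup M] [Module C M] [AddCommGroup X] [Module C X] :
    InAdd C M X ↔ ∃ (k : ℕ) (i : Fin k → X →ₗ[C] M) (p : Fin k → M →ₗ[C] X),
      ∀ x, ∑ j, p j (i j x) = x := by
  constructor
  · rintro ⟨k, i, p, hpi⟩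
    refine ⟨k, fun j => LinearMap.proj j ∘ₗ i, fun j => p ∘ₗ LinearMap.single C (fun _ => M) j, fun x => ?_⟩
    have := LinearMap.congr_fun hpi x
    simp only [LinearMap.comp_apply, LinearMap.id_apply] at this
    conv_rhs => rw [← this, ← Finset.univ_sum_single (i x), map_sum]
    simp
  · rintro ⟨k, i, p, h⟩
    refine ⟨k, LinearMap.pi i, LinearMap.lsum C _ ℕ p, LinearMap.ext fun x => ?_⟩
    simpa using h x

theorem InAdd.pi {M : Type u} [AddCommGroup M] [Module C M] (k : ℕ) : InAdd C M (Fin k → M) :=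
  ⟨k, LinearMap.id, LinearMap.id, rfl⟩

theorem InAdd.isRProj {R : Type u} [CommRing R] [Algebra R C] {M X : Type u} [AddCommGroup M]
    [Module C M] [AddCommGroup X] [Module C X] [Module R M] [Module R X] [IsScalarTower R C M]
    [IsScalarTower R C X] (h : InAdd C M X) (hM : IsRProj R M) : IsRProj R X := by
  obtain ⟨k, i, p, hpi⟩ := h
  exact (hM.pi k).of_retract (i.restrictScalars R) (p.restrictScalars R) fun x =>
    LinearMap.congr_fun hpi x

end Add

/-! ### The tensor product over a noncommutative ring -/

section Tensor

variable {R : Type u} [CommRing R] {A : Type u} [Ring A]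

namespace TensorOver

section

variable {N : Type u} [AddCommGroup N] [Module R N] [Module Aᵐᵒᵖ N]
  {X : Type u} [AddCommGroup X] [Module A X]

variable (R A) in
/-- The class of `n ⊗ x` in `N ⊗_A X`. -/
def tmul (n : N) (x : X) : TensorOver R A N X := Submodule.Quotient.mk (n ⊗ₜ[ℤ] x)

theorem add_tmul (n n' : N) (x : X) : tmul R A (n + n') x = tmul R A n x + tmul R A n' x :=
  congrArg (Submodule.Quotient.mk (p := tensorRel R A N X)) (TensorProduct.add_tmul n n' x)

theorem tmul_add (n : N) (x x' : X) : tmul R A n (x + x') = tmul R A n x + tmul R A n x' :=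
  congrArg (Submodule.Quotient.mk (p := tensorRel R A N X)) (TensorProduct.tmul_add n x x')

theorem base_smul_tmul (r : R) (n : N) (x : X) : tmul R A (r • n) x = r • tmul R A n x := rfl

/-- `tmul` as a bi-additive map. -/
def tmulHom (R A N X : Type u) [CommRing R] [Ring A] [AddCommGroup N] [Module R N] [Module Aᵐᵒᵖ N]
    [AddCommGroup X] [Module A X] : N →+ X →+ TensorOver R A N X :=
  AddMonoidHom.mk' (fun n => AddMonoidHom.mk' (tmul R A n) (tmul_add n))
    fun n n' => AddMonoidHom.ext (add_tmul n n')

@[simp] theorem tmul_zero (n : N) : tmul R A n (0 : X) = 0 := map_zero (tmulHom R A N X n)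

@[simp] theorem zero_tmul (x : X) : tmul R A (0 : N) x = 0 := by
  have := map_zero (tmulHom R A N X)
  exact DFunLike.congr_fun this x

theorem sum_tmul {ι : Type*} (s : Finset ι) (n : ι → N) (x : X) :
    tmul R A (∑ i ∈ s, n i) x = ∑ i ∈ s, tmul R A (n i) x := by
  have := map_sum (tmulHom R A N X) n s
  exact (DFunLike.congr_fun this x).trans (AddMonoidHom.finsetSum_apply _ s x)

theorem tmul_sum {ι : Type*} (s : Finset ι) (n : N) (x : ι → X) :
    tmul R A n (∑ i ∈ s, x i) = ∑ i ∈ s, tmul R A n (x i) :=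
  map_sum (tmulHom R A N X n) x s

theorem op_smul_tmul (a : A) (n : N) (x : X) :
    tmul R A (op a • n) x = tmul R A n (a • x) :=
  (Submodule.Quotient.eq _).2 (Submodule.subset_span ⟨n, a, x, rfl⟩)

@[elab_as_elim]
theorem induction_on {p : TensorOver R A N X → Prop} (t : TensorOver R A N X) (h0 : p 0)
    (h1 : ∀ n x, p (tmul R A n x)) (h2 : ∀ s t, p s → p t → p (s + t)) : p t := by
  obtain ⟨t, rfl⟩ := Submodule.Quotient.mk_surjective _ t
  induction t with
  | zero => exact h0
  | add x y hx hy => exact h2 _ _ hx hy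
  | tmul n x => exact h1 n x

/-- Every element is a finite sum of pure tensors. -/
theorem exists_sum (t : TensorOver R A N X) :
    ∃ (k : ℕ) (n : Fin k → N) (x : Fin k → X), t = ∑ i, tmul R A (n i) (x i) := by
  induction t using induction_on with
  | h0 => exact ⟨0, Fin.elim0, Fin.elim0, by simp⟩
  | h1 n x => exact ⟨1, fun _ => n, fun _ => x, by simp⟩
  | h2 s t hs ht =>
    obtain ⟨k, n, x, rfl⟩ := hs
    obtain ⟨l, n', x', rfl⟩ := ht
    exact ⟨k + l, Fin.append n n', Fin.append x x', by simp [Fin.sum_univ_add]⟩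

theorem hom_ext {G : Type*} [AddCommGroup G] [Module R G] {f g : TensorOver R A N X →ₗ[R] G}
    (h : ∀ n x, f (tmul R A n x) = g (tmul R A n x)) : f = g := by
  refine LinearMap.ext fun t => ?_
  induction t using induction_on with
  | h0 => simp
  | h1 n x => exact h n x
  | h2 s t hs ht => simp [hs, ht]

/-- The map `N ⊗_A X → G` induced by an `A`-balanced bi-additive map which is `R`-linear in `N`. -/
def lift {G : Type*} [AddCommGroup G] [Module R G] (f : N → X → G)
    (h1 : ∀ n n' x, f (n + n') x = f n x + f n' x) (h2 : ∀ n x x', f n (x + x') = f n x + f n x')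
    (h3 : ∀ (r : R) n x, f (r • n) x = r • f n x) (h4 : ∀ (a : A) n x, f (op a • n) x = f n (a • x)) :
    TensorOver R A N X →ₗ[R] G :=
  Submodule.liftQ _ (TensorProduct.AlgebraTensorModule.lift
    { toFun n := (AddMonoidHom.mk' (f n) (h2 n)).toIntLinearMap
      map_add' n n' := LinearMap.ext (h1 n n')
      map_smul' r n := LinearMap.ext (h3 r n) }) (Submodule.span_le.2 (by
        rintro _ ⟨n, a, x, rfl⟩
        simp [h4]))

@[simp] theorem lift_tmul {G : Type*} [AddCommGroup G] [Module R G] (f : N → X → G)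
    (h1 h2 h3 h4) (n : N) (x : X) :
    lift (R := R) (A := A) f h1 h2 h3 h4 (tmul R A n x) = f n x := rfl

@[simp] theorem tensorMap_tmul {Y : Type u} [AddCommGroup Y] [Module A Y]
    (f : X →ₗ[A] Y)
    (n : N) (x : X) : tensorMap R A N f (tmul R A n x) = tmul R A n (f x) := rfl

variable {Y Z : Type u} [AddCommGroup Y] [Module A Y] [AddCommGroup Z] [Module A Z]

theorem tensorMap_surjective {g : Y →ₗ[A] Z} (hg : Function.Surjective g) :
    Function.Surjective (tensorMap R A N g) := fun t => by
  induction t using induction_on with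
  | h0 => exact ⟨0, map_zero _⟩
  | h1 n z =>
    obtain ⟨y, rfl⟩ := hg z
    exact ⟨tmul R A n y, rfl⟩
  | h2 s t hs ht =>
    obtain ⟨s, rfl⟩ := hs
    obtain ⟨t, rfl⟩ := ht
    exact ⟨s + t, map_add _ _ _⟩

/-- Right exactness of `N ⊗_A -`. -/
theorem tensorMap_exact {f : X →ₗ[A] Y} {g : Y →ₗ[A] Z} (hfg : Function.Exact f g)
    (hg : Function.Surjective g) :
    Function.Exact (tensorMap R A N f) (tensorMap R A N g) := by
  have key : ∀ (n : N) (y y' : Y), g y = g y' →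
      (LinearMap.range (tensorMap R A N f)).mkQ (tmul R A n y) =
        (LinearMap.range (tensorMap R A N f)).mkQ (tmul R A n y') := by
    intro n y y' h
    obtain ⟨x, hx⟩ := (hfg (y - y')).1 (by rw [map_sub, h, sub_self])
    refine (Submodule.Quotient.eq _).2 ⟨tmul R A n x, ?_⟩
    rw [tensorMap_tmul, hx]
    exact map_sub (tmulHom R A N Y n) y y'
  let inv : TensorOver R A N Z →ₗ[R] _ :=
    lift (fun n z => (LinearMap.range (tensorMap R A N f)).mkQ (tmul R A n (Function.surjInv hg z)))
      (fun n n' x => by rw [add_tmul, map_add])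
      (fun n z z' => by
        rw [← map_add, ← tmul_add]
        exact key _ _ _ (by simp [Function.surjInv_eq]))
      (fun r n x => by rw [base_smul_tmul, map_smul])
      (fun a n z => by
        rw [op_smul_tmul]
        exact key _ _ _ (by simp [Function.surjInv_eq]))
  have hinv : inv ∘ₗ tensorMap R A N g = (LinearMap.range (tensorMap R A N f)).mkQ :=
    hom_ext fun n y => key _ _ _ (by simp [Function.surjInv_eq])
  intro t
  constructor
  · intro ht
    have := LinearMap.congr_fun hinv t
    rw [LinearMap.comp_apply, ht, map_zero] at this
    exact (Submodule.Quotient.mk_eq_zero _).1 this.symm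
  · rintro ⟨s, rfl⟩
    have : g ∘ₗ f = 0 := LinearMap.ext hfg.apply_apply_eq_zero
    rw [← LinearMap.comp_apply, ← tensorMap_comp, this]
    induction s using induction_on with
    | h0 => simp
    | h1 n x => simp
    | h2 s t hs ht => simp [hs, ht]

end

variable [Algebra R A]
variable {N N' N'' : Type u} [AddCommGroup N] [Module R N] [Module Aᵐᵒᵖ N] [IsScalarTower R Aᵐᵒᵖ N]
  [AddCommGroup N'] [Module R N'] [Module Aᵐᵒᵖ N'] [IsScalarTower R Aᵐᵒᵖ N']
  [AddCommGroup N''] [Module R N''] [Module Aᵐᵒᵖ N''] [IsScalarTower R Aᵐᵒᵖ N'']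
  {X Y Z : Type u} [AddCommGroup X] [Module A X] [AddCommGroup Y] [Module A Y]
  [AddCommGroup Z] [Module A Z]

variable (R X) in
/-- `g ⊗_A X : N ⊗_A X → N' ⊗_A X`. -/
def rmap (g : N →ₗ[Aᵐᵒᵖ] N') : TensorOver R A N X →ₗ[R] TensorOver R A N' X :=
  lift (fun n x => tmul R A (g n) x) (fun n n' x => by rw [map_add, add_tmul])
    (fun n x x' => tmul_add _ _ _)
    (fun r n x => by rw [LinearMap.map_smul_of_tower, base_smul_tmul])
    (fun a n x => by rw [map_smul, op_smul_tmul])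

@[simp] theorem rmap_tmul (g : N →ₗ[Aᵐᵒᵖ] N') (n : N) (x : X) :
    rmap R X g (tmul R A n x) = tmul R A (g n) x := rfl

theorem rmap_tensorMap (g : N →ₗ[Aᵐᵒᵖ] N') (f : X →ₗ[A] Y) (t : TensorOver R A N X) :
    rmap R Y g (tensorMap R A N f t) = tensorMap R A N' f (rmap R X g t) := by
  have : rmap R Y g ∘ₗ tensorMap R A N f = tensorMap R A N' f ∘ₗ rmap R X g :=
    hom_ext fun n x => rfl
  exact LinearMap.congr_fun this t

theorem rmap_surjective {g : N →ₗ[Aᵐᵒᵖ] N'} (hg : Function.Surjective g) :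
    Function.Surjective (rmap R X g) := fun t => by
  induction t using induction_on with
  | h0 => exact ⟨0, map_zero _⟩
  | h1 n z =>
    obtain ⟨y, rfl⟩ := hg n
    exact ⟨tmul R A y z, rfl⟩
  | h2 s t hs ht =>
    obtain ⟨s, rfl⟩ := hs
    obtain ⟨t, rfl⟩ := ht
    exact ⟨s + t, map_add _ _ _⟩

/-- Right exactness of `- ⊗_A X`. -/
theorem rmap_exact {f : N →ₗ[Aᵐᵒᵖ] N'} {g : N' →ₗ[Aᵐᵒᵖ] N''} (hfg : Function.Exact f g)
    (hg : Function.Surjective g) :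
    Function.Exact (rmap R X f) (rmap R X g) := by
  have key : ∀ (y y' : N') (x : X), g y = g y' →
      (LinearMap.range (rmap R X f)).mkQ (tmul R A y x) =
        (LinearMap.range (rmap R X f)).mkQ (tmul R A y' x) := by
    intro y y' x h
    obtain ⟨n, hn⟩ := (hfg (y - y')).1 (by rw [map_sub, h, sub_self])
    refine (Submodule.Quotient.eq _).2 ⟨tmul R A n x, ?_⟩
    rw [rmap_tmul, hn]
    exact map_sub ((tmulHom R A N' X).flip x) y y'
  let inv : TensorOver R A N'' X →ₗ[R] _ :=
    lift (fun n x => (LinearMap.range (rmap R X f)).mkQ (tmul R A (Function.surjInv hg n) x))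
      (fun n n' x => by
        rw [← map_add, ← add_tmul]
        exact key _ _ _ (by simp [Function.surjInv_eq]))
      (fun n x x' => by rw [tmul_add, map_add])
      (fun r n x => by
        rw [← map_smul, ← base_smul_tmul]
        exact key _ _ _ (by
          rw [LinearMap.map_smul_of_tower, Function.surjInv_eq hg, Function.surjInv_eq hg]))
      (fun a n z => by
        rw [← op_smul_tmul]
        exact key _ _ _ (by simp [Function.surjInv_eq]))
  have hinv : inv ∘ₗ rmap R X g = (LinearMap.range (rmap R X f)).mkQ :=
    hom_ext fun n y => key _ _ _ (by simp [Function.surjInv_eq])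
  intro t
  constructor
  · intro ht
    have := LinearMap.congr_fun hinv t
    rw [LinearMap.comp_apply, ht, map_zero] at this
    exact (Submodule.Quotient.mk_eq_zero _).1 this.symm
  · rintro ⟨s, rfl⟩
    induction s using induction_on with
    | h0 => simp
    | h1 n x => simp [hfg.apply_apply_eq_zero]
    | h2 s t hs ht => simp [hs, ht]

/-- For a coordinate function `φ : Q → A` on a right module, the map `q ⊗ x ↦ φ(q) x`. -/
def coord {Q : Type u} [AddCommGroup Q] [Module R Q] [Module Aᵐᵒᵖ Q] [IsScalarTower R Aᵐᵒᵖ Q]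
    [Module R X] [IsScalarTower R A X] (φ : Q →ₗ[Aᵐᵒᵖ] A) : TensorOver R A Q X →ₗ[R] X :=
  lift (fun q x => φ q • x) (fun q q' x => by rw [map_add, add_smul]) (fun q x x' => smul_add _ _ _)
    (fun r q x => by rw [LinearMap.map_smul_of_tower, smul_assoc])
    (fun a q x => by rw [map_smul, op_smul_eq_mul, mul_smul])

@[simp] theorem coord_tmul {Q : Type u} [AddCommGroup Q] [Module R Q] [Module Aᵐᵒᵖ Q]
    [IsScalarTower R Aᵐᵒᵖ Q] [Module R X] [IsScalarTower R A X] (φ : Q →ₗ[Aᵐᵒᵖ] A) (q : Q) (x : X) :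
    coord φ (tmul R A q x) = φ q • x := rfl

/-- Expansion of a tensor in a dual basis of a projective right module. -/
theorem sum_tmul_coord {Q : Type u} [AddCommGroup Q] [Module R Q] [Module Aᵐᵒᵖ Q]
    [IsScalarTower R Aᵐᵒᵖ Q] [Module R X] [IsScalarTower R A X] {k : ℕ}
    {i : Fin k → Q →ₗ[Aᵐᵒᵖ] A} {p : Fin k → A →ₗ[Aᵐᵒᵖ] Q} (h : ∀ q, ∑ j, p j (i j q) = q)
    (t : TensorOver R A Q X) : ∑ j, tmul R A (p j 1) (coord (i j) t) = t := by
  induction t using induction_on with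
  | h0 => simp
  | h1 q x =>
    simp only [coord_tmul, ← op_smul_tmul, ← map_smul, op_smul_eq_mul, one_mul, ← sum_tmul, h]
  | h2 s t hs ht => simp only [map_add, tmul_add, Finset.sum_add_distrib, hs, ht]

/-- A finitely generated projective right module is flat. -/
theorem tensorMap_injective {Q : Type u} [AddCommGroup Q] [Module R Q] [Module Aᵐᵒᵖ Q]
    [IsScalarTower R Aᵐᵒᵖ Q] (hQ : InAdd Aᵐᵒᵖ A Q) {f : X →ₗ[A] Y} (hf : Function.Injective f) :
    Function.Injective (tensorMap R A Q f) := by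
  let _ : Module R X := Module.compHom X (algebraMap R A)
  have : IsScalarTower R A X := ⟨fun r a x => by
    rw [Algebra.smul_def, mul_smul]
    rfl⟩
  let _ : Module R Y := Module.compHom Y (algebraMap R A)
  have : IsScalarTower R A Y := ⟨fun r a x => by
    rw [Algebra.smul_def, mul_smul]
    rfl⟩
  obtain ⟨k, i, p, hpi⟩ := inAdd_iff.1 hQ
  rw [injective_iff_map_eq_zero]
  intro t ht
  have nat : ∀ j, f (coord (i j) t) = coord (i j) (tensorMap R A Q f t) := fun j => by
    have : f.restrictScalars R ∘ₗ coord (i j) = coord (i j) ∘ₗ tensorMap R A Q f :=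
      hom_ext fun q x => by simp
    exact LinearMap.congr_fun this t
  rw [← sum_tmul_coord hpi t]
  refine Finset.sum_eq_zero fun j _ => ?_
  have : coord (i j) t = 0 := hf (by rw [nat, ht, map_zero, map_zero])
  rw [this, tmul_zero]

/-- A projective left module is flat. -/
theorem rmap_injective [Module.Projective A X] {g : N →ₗ[Aᵐᵒᵖ] N'} (hg : Function.Injective g) :
    Function.Injective (rmap R X g) := by
  obtain ⟨s, hs⟩ := Module.projective_def.1 (inferInstance : Module.Projective A X)
  -- the coordinates of `n ⊗ x` in a dual basis of `X`
  let co : ∀ (K : Type u) [AddCommGroup K] [Module R K] [Module Aᵐᵒᵖ K] [IsScalarTower R Aᵐᵒᵖ K],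
      X → (TensorOver R A K X →ₗ[R] K) := fun K _ _ _ _ y =>
    lift (fun n x => op (s x y) • n) (fun n n' x => smul_add _ _ _)
      (fun n x x' => by simp [add_smul]) (fun r n x => smul_comm _ _ _)
      (fun a n x => by simp [mul_smul])
  classical
  have expand : ∀ t : TensorOver R A N X, (∀ y, co N y t = 0) → t = 0 := by
    intro t ht
    obtain ⟨k, n, x, rfl⟩ := exists_sum t
    have h : ∀ i, tmul R A (n i) (x i) =
        ∑ y ∈ Finset.univ.biUnion fun j => (s (x j)).support,
          tmul R A (op (s (x i) y) • n i) y := by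
      intro i
      conv_lhs => rw [← hs (x i), Finsupp.linearCombination_apply, Finsupp.sum, tmul_sum]
      simp only [op_smul_tmul, id]
      refine Finset.sum_subset (fun y hy => Finset.mem_biUnion.2 ⟨i, Finset.mem_univ _, hy⟩) ?_
      intro y _ hy
      rw [Finsupp.notMem_support_iff.1 hy, zero_smul, tmul_zero]
    rw [Finset.sum_congr rfl fun i _ => h i, Finset.sum_comm]
    refine Finset.sum_eq_zero fun y _ => ?_
    have := ht y
    rw [map_sum] at this
    rw [← sum_tmul]
    exact (congrArg (fun z => tmul R A z y) this).trans (zero_tmul y)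
  rw [injective_iff_map_eq_zero]
  intro t ht
  refine expand t fun y => hg ?_
  have nat : g.restrictScalars R ∘ₗ co N y = co N' y ∘ₗ rmap R X g :=
    hom_ext fun n x => g.map_smul _ _
  rw [map_zero]
  exact (LinearMap.congr_fun nat t).trans (by rw [LinearMap.comp_apply, ht, map_zero])

/-- Symmetry of `Tor₁`: it may be computed from a presentation of either variable. -/
theorem injective_iff_of_exact {K Q L : Type u}
    [AddCommGroup K] [Module R K] [Module Aᵐᵒᵖ K] [IsScalarTower R Aᵐᵒᵖ K]
    [AddCommGroup Q] [Module R Q] [Module Aᵐᵒᵖ Q] [IsScalarTower R Aᵐᵒᵖ Q]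
    [AddCommGroup L] [Module R L] [Module Aᵐᵒᵖ L] [IsScalarTower R Aᵐᵒᵖ L]
    (hQ : InAdd Aᵐᵒᵖ A Q) [Module.Projective A Y]
    {ι : K →ₗ[Aᵐᵒᵖ] Q} {q : Q →ₗ[Aᵐᵒᵖ] L} (hι : Function.Injective ι) (hιq : Function.Exact ι q)
    (hq : Function.Surjective q) {j : X →ₗ[A] Y} {π : Y →ₗ[A] Z} (hj : Function.Injective j)
    (hjπ : Function.Exact j π) (hπ : Function.Surjective π) :
    Function.Injective (tensorMap R A L j) ↔ Function.Injective (rmap R Z ι) := by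
  have hQj : Function.Injective (tensorMap R A Q j) := tensorMap_injective hQ hj
  have hYι : Function.Injective (rmap R Y ι) := rmap_injective hι
  simp only [injective_iff_map_eq_zero (tensorMap R A L j), injective_iff_map_eq_zero (rmap R Z ι)]
  constructor
  · intro h z hz
    obtain ⟨z, rfl⟩ := tensorMap_surjective hπ z
    rw [rmap_tensorMap] at hz
    obtain ⟨v, hv⟩ := (tensorMap_exact hjπ hπ _).1 hz
    have hw : rmap R X q v = 0 := h _ (by
      rw [← rmap_tensorMap, hv, (rmap_exact hιq hq).apply_apply_eq_zero])
    obtain ⟨v, rfl⟩ := (rmap_exact hιq hq _).1 hw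
    rw [← rmap_tensorMap] at hv
    rw [← hYι hv, (tensorMap_exact hjπ hπ).apply_apply_eq_zero]
  · intro h w hw
    obtain ⟨v, rfl⟩ := rmap_surjective hq w
    rw [← rmap_tensorMap] at hw
    obtain ⟨z, hz⟩ := (rmap_exact hιq hq _).1 hw
    have hu : tensorMap R A K π z = 0 := h _ (by
      rw [rmap_tensorMap, hz, (tensorMap_exact hjπ hπ).apply_apply_eq_zero])
    obtain ⟨z, rfl⟩ := (tensorMap_exact hjπ hπ _).1 hu
    rw [rmap_tensorMap] at hz
    rw [← hQj hz, (rmap_exact hιq hq).apply_apply_eq_zero]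

end TensorOver

end Tensor

/-! ### Vanishing of `Tor` -/

section Tor

/-- A projective resolution `⋯ → X 1 → X 0 → M → 0`, in terms of modules. -/
structure ModuleResolution (A : Type u) [Ring A] (M : Type u) [AddCommGroup M] [Module A M] where
  /-- the terms -/
  X : ℕ → Type u
  [addCommGroup : ∀ i, AddCommGroup (X i)]
  [module : ∀ i, Module A (X i)]
  [projective : ∀ i, Module.Projective A (X i)]
  /-- the differentials -/
  d : ∀ i, X (i + 1) →ₗ[A] X i
  /-- the augmentation -/
  π : X 0 →ₗ[A] M
  surjective_π : Function.Surjective π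
  exact_zero : Function.Exact (d 0) π
  exact_succ : ∀ i, Function.Exact (d (i + 1)) (d i)

attribute [instance] ModuleResolution.addCommGroup ModuleResolution.module
  ModuleResolution.projective

namespace ModuleResolution

variable {R : Type u} [CommRing R] {A : Type u} [Ring A]
  {M : Type u} [AddCommGroup M] [Module A M]

/-- The modules underlying a projective resolution in the category of modules. -/
noncomputable def ofProjectiveResolution (P : ProjectiveResolution (ModuleCat.of A M)) :
    ModuleResolution A M where
  X i := P.complex.X i
  projective i := (IsProjective.iff_projective _).2 (P.projective i)
  d i := (P.complex.d (i + 1) i).hom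
  π := (P.π.f 0).hom
  surjective_π := (ModuleCat.epi_iff_surjective (P.π.f 0)).1 inferInstance
  exact_zero := (ShortComplex.ShortExact.moduleCat_exact_iff_function_exact _).1 P.exact₀
  exact_succ i := (ShortComplex.ShortExact.moduleCat_exact_iff_function_exact _).1 (P.exact_succ i)

variable (P : ModuleResolution A M)

/-- The vanishing of `Tor_{i+1}(L, M)`, in the form that `L ⊗_A -` preserves the injectivity of
the inclusion of the `(i+1)`-st syzygy of `M` into the `i`-th term of the resolution `P`. -/
def TorVanish (R : Type u) [CommRing R] (L : Type u) [AddCommGroup L] [Module R L] [Module Aᵐᵒᵖ L]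
    (i : ℕ) : Prop :=
  Function.Injective (tensorMap R A L (LinearMap.range (P.d i)).subtype)

variable {L : Type u} [AddCommGroup L] [Module R L] [Module Aᵐᵒᵖ L]

theorem exact_rangeRestrict (i : ℕ) :
    Function.Exact (P.d (i + 1)) (P.d i).rangeRestrict := fun x => by
  rw [← P.exact_succ i x, ← LinearMap.mem_ker, LinearMap.ker_rangeRestrict, LinearMap.mem_ker]

theorem torVanish_iff_exact (i : ℕ) :
    P.TorVanish R L i ↔
      Function.Exact (tensorMap R A L (P.d (i + 1))) (tensorMap R A L (P.d i)) := by
  have hfac : ∀ t, tensorMap R A L (P.d i) t = tensorMap R A L (LinearMap.range (P.d i)).subtype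
      (tensorMap R A L (P.d i).rangeRestrict t) := fun t => by
    rw [← LinearMap.comp_apply, ← tensorMap_comp]
    rfl
  have hex := TensorOver.tensorMap_exact (R := R) (N := L) (P.exact_rangeRestrict i)
    (P.d i).surjective_rangeRestrict
  constructor
  · intro h t
    rw [← hex t, hfac]
    exact map_eq_zero_iff _ h
  · intro h
    rw [TorVanish, injective_iff_map_eq_zero]
    intro t ht
    obtain ⟨t, rfl⟩ := TensorOver.tensorMap_surjective (P.d i).surjective_rangeRestrict t
    rw [← hfac] at ht
    exact (hex t).2 ((h t).1 ht)

theorem isZero_torOver_iff (P : ProjectiveResolution (ModuleCat.of A M)) (i : ℕ) :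
    Limits.IsZero (TorOver R A L (i + 1) M) ↔ (ofProjectiveResolution P).TorVanish R L i := by
  rw [torVanish_iff_exact, TorOver, (P.isoLeftDerivedObj (tensorFunctor R A L) (i + 1)).isZero_iff]
  rw [show Limits.IsZero ((HomologicalComplex.homologyFunctor (ModuleCat R) (ComplexShape.down ℕ)
    (i + 1)).obj (((tensorFunctor R A L).mapHomologicalComplex (ComplexShape.down ℕ)).obj
      P.complex)) ↔ _ from (HomologicalComplex.exactAt_iff_isZero_homology _ _).symm,
    HomologicalComplex.exactAt_iff' _ (i + 2) (i + 1) i (by simp only [ChainComplex.prev]; rfl)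
      (by simp), ShortComplex.ShortExact.moduleCat_exact_iff_function_exact]
  rfl

variable [Algebra R A] [IsScalarTower R Aᵐᵒᵖ L]

theorem torVanish_of_inAdd (hL : InAdd Aᵐᵒᵖ A L) (i : ℕ) : P.TorVanish R L i :=
  TensorOver.tensorMap_injective hL (Submodule.injective_subtype _)

variable {K Q : Type u}
  [AddCommGroup K] [Module R K] [Module Aᵐᵒᵖ K] [IsScalarTower R Aᵐᵒᵖ K]
  [AddCommGroup Q] [Module R Q] [Module Aᵐᵒᵖ Q] [IsScalarTower R Aᵐᵒᵖ Q]
  (hQ : InAdd Aᵐᵒᵖ A Q) {ι : K →ₗ[Aᵐᵒᵖ] Q} {q : Q →ₗ[Aᵐᵒᵖ] L} (hι : Function.Injective ι)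
  (hιq : Function.Exact ι q) (hq : Function.Surjective q)

include hQ hι hιq hq

/-- `Tor₁(L, M)` is the kernel of `K ⊗_A M → Q ⊗_A M`. -/
theorem torVanish_zero_iff : P.TorVanish R L 0 ↔ Function.Injective (TensorOver.rmap R M ι) :=
  TensorOver.injective_iff_of_exact hQ hι hιq hq (Submodule.injective_subtype _)
    (fun x => by rw [P.exact_zero x, ← LinearMap.coe_range]; simp) P.surjective_π

/-- Dimension shifting. -/
theorem torVanish_succ_iff (i : ℕ) : P.TorVanish R L (i + 1) ↔ P.TorVanish R K i := by
  have h : P.TorVanish R L (i + 1) ↔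
      Function.Injective (TensorOver.rmap R (LinearMap.range (P.d i)) ι) :=
    TensorOver.injective_iff_of_exact hQ hι hιq hq (Submodule.injective_subtype _)
      (fun x => by
        rw [P.exact_rangeRestrict i x, ← LinearMap.coe_range]; simp)
      (P.d i).surjective_rangeRestrict
  rw [h]
  have h1 : Function.Injective (tensorMap R A Q (LinearMap.range (P.d i)).subtype) :=
    P.torVanish_of_inAdd hQ i
  have h2 : Function.Injective (TensorOver.rmap R (P.X i) ι) := TensorOver.rmap_injective hι
  rw [TorVanish, ← h1.of_comp_iff, ← h2.of_comp_iff]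
  have : ∀ t, TensorOver.rmap R (P.X i) ι (tensorMap R A K (LinearMap.range (P.d i)).subtype t) = _ :=
    TensorOver.rmap_tensorMap ι (LinearMap.range (P.d i)).subtype
  rw [show (TensorOver.rmap R (P.X i) ι) ∘ (tensorMap R A K (LinearMap.range (P.d i)).subtype) = _
    from funext this]
  rfl

end ModuleResolution

end Tor

/-! ### Finite resolutions, built one kernel at a time -/

section Resolutions

variable (R : Type u) [CommRing R]

/-- `N` has a finite resolution of length `k` as in `HasAddResolution`, described recursively: either
`k = 0` and `N ∈ add M`, or `N` is the target of a suitable surjection from an object of `add M`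
whose kernel has such a resolution of length `k - 1`. -/
def AddRes (C : Type u) [Ring C] [Algebra R C] (M : Type u) [AddCommGroup M] [Module C M] :
    ℕ → ∀ (N : Type u) [AddCommGroup N] [Module R N] [Module C N], Prop
  | 0, N, _, _, _ => InAdd C M N
  | k + 1, N, _, _, _ => ∃ (X : AlgMod R C) (p : X →ₗ[C] N), InAdd C M X ∧
      Function.Surjective p ∧ IsSplitOver R p ∧ Function.Surjective (homFrom M p) ∧
      AddRes C M k (LinearMap.ker p)

/-- The right `A`-module `N` has a resolution of length `k` by finitely generated projective
modules. -/
def ProjRes (A : Type u) [Ring A] [Algebra R A] :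
    ℕ → ∀ (N : Type u) [AddCommGroup N] [Module Aᵐᵒᵖ N], Prop
  | 0, N, _, _ => InAdd Aᵐᵒᵖ A N
  | k + 1, N, _, _ => ∃ (X : AlgMod R Aᵐᵒᵖ) (p : X →ₗ[Aᵐᵒᵖ] N), InAdd Aᵐᵒᵖ A X ∧
      Function.Surjective p ∧ ProjRes A k (LinearMap.ker p)

variable {R} {C : Type u} [Ring C] [Algebra R C] {M : Type u} [AddCommGroup M] [Module C M]

theorem HasAddResolution.addRes {k : ℕ} : ∀ {N : Type u} [AddCommGroup N] [Module R N] [Module C N]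
    [IsScalarTower R C N], HasAddResolution R C M N k → AddRes R C M k N := by
  induction k with
  | zero =>
    rintro N _ _ _ _ ⟨X, d, ⟨e⟩, hadd, hzero, hsurj, hex, -, -, -⟩
    refine (hadd 0 le_rfl).congr ((LinearEquiv.ofBijective (d 0) ⟨?_, hsurj⟩).trans e)
    rw [injective_iff_map_eq_zero]
    intro x hx
    obtain ⟨y, rfl⟩ := (hex 0 x).1 hx
    have := hzero 2 le_rfl
    rw [Subsingleton.elim y 0, map_zero]
  | succ k ih =>
    rintro N _ _ _ _ ⟨X, d, ⟨e⟩, hadd, hzero, hsurj, hex, hsplit, hhsurj, hhex⟩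
    refine ⟨X 1, e.toLinearMap ∘ₗ d 0, hadd 0 (Nat.zero_le _), e.surjective.comp hsurj, ?_, ?_, ?_⟩
    · obtain ⟨s, hs⟩ := hsplit 0
      refine ⟨s ∘ₗ (e.symm.restrictScalars R).toLinearMap, fun x => ?_⟩
      exact congrArg e ((congrArg (fun y => d 0 (s y)) (e.symm_apply_apply _)).trans (hs x))
    · intro g
      obtain ⟨f, hf⟩ := hhsurj (e.symm.toLinearMap ∘ₗ g)
      refine ⟨f, LinearMap.ext fun m => ?_⟩
      exact (congrArg e (LinearMap.congr_fun hf m)).trans (e.apply_symm_apply _)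
    · have hker : ∀ x : X 1, x ∈ LinearMap.ker (e.toLinearMap ∘ₗ d 0) ↔ d 0 x = 0 := fun x => by
        simp
      refine ih ⟨fun | 0 => ⟨LinearMap.ker (e.toLinearMap ∘ₗ d 0)⟩ | i + 1 => X (i + 2),
        fun | 0 => (d 1).codRestrict _ fun x =>
                (hker _).2 ((hex 0).apply_apply_eq_zero x) | i + 1 => d (i + 2),
        ⟨LinearEquiv.refl C _⟩, fun i hi => hadd (i + 1) (by omega), ?_, ?_, ?_, ?_, ?_, ?_⟩
      · rintro (_ | i) hi
        · omega
        · exact hzero (i + 2) (by omega)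
      · rintro ⟨x, hx⟩
        obtain ⟨y, hy⟩ := (hex 0 x).1 ((hker x).1 hx)
        exact ⟨y, Subtype.ext hy⟩
      · rintro (_ | i)
        · intro x
          rw [← hex 1 x]
          exact Subtype.ext_iff
        · exact hex (i + 2)
      · rintro (_ | i)
        · obtain ⟨s, hs⟩ := hsplit 1
          exact ⟨s ∘ₗ (Submodule.subtype _).restrictScalars R, fun x => Subtype.ext (hs x)⟩
        · exact hsplit (i + 2)
      · intro g
        obtain ⟨f, hf⟩ := (hhex 0 ((Submodule.subtype _) ∘ₗ g)).1
          (LinearMap.ext fun m => (hker _).1 (g m).2)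
        exact ⟨f, LinearMap.ext fun m => Subtype.ext (LinearMap.congr_fun hf m)⟩
      · rintro (_ | i)
        · intro g
          rw [← hhex 1 g]
          constructor
          · intro h
            exact LinearMap.ext fun m => congrArg Subtype.val (LinearMap.congr_fun h m)
          · intro h
            exact LinearMap.ext fun m => Subtype.ext (LinearMap.congr_fun h m)
        · exact hhex (i + 2)

theorem AddRes.hasAddResolution {k : ℕ} : ∀ {N : Type u} [AddCommGroup N] [Module R N] [Module C N]
    [IsScalarTower R C N], AddRes R C M k N → HasAddResolution R C M N k := by
  induction k with
  | zero =>
    intro N _ _ _ _ h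
    let Z : AlgMod R C := ⟨PUnit⟩
    have hZ : Subsingleton Z := inferInstanceAs (Subsingleton PUnit)
    refine ⟨fun | 0 => ⟨N⟩ | 1 => ⟨N⟩ | _ + 2 => Z,
      fun | 0 => LinearMap.id | 1 => 0 | _ + 2 => 0, ⟨LinearEquiv.refl C _⟩, ?_, ?_,
      fun x => ⟨x, rfl⟩, ?_, ?_, fun g => ⟨g, rfl⟩, ?_⟩
    · rintro (_ | i) hi
      · exact h
      · omega
    · rintro (_ | _ | i) hi
      · omega
      · omega
      · exact hZ
    · rintro (_ | _ | i) x
      · exact ⟨fun h => ⟨0, h.symm⟩, fun ⟨_, hy⟩ => hy.symm⟩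
      · exact ⟨fun _ => ⟨0, hZ.elim _ _⟩, fun _ => rfl⟩
      · exact ⟨fun _ => ⟨0, hZ.elim _ _⟩, fun _ => rfl⟩
    · rintro (_ | _ | i)
      · exact ⟨LinearMap.id, fun _ => rfl⟩
      · exact ⟨0, fun _ => rfl⟩
      · exact ⟨0, fun _ => rfl⟩
    · rintro (_ | _ | i) g
      · exact ⟨fun h => ⟨0, LinearMap.ext fun m => (LinearMap.congr_fun h m).symm⟩,
          fun ⟨_, hy⟩ => LinearMap.ext fun m => (LinearMap.congr_fun hy m).symm⟩
      · exact ⟨fun _ => ⟨0, LinearMap.ext fun m => hZ.elim _ _⟩, fun _ => rfl⟩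
      · exact ⟨fun _ => ⟨0, LinearMap.ext fun m => hZ.elim _ _⟩, fun _ => rfl⟩
  | succ k ih =>
    rintro N _ _ _ _ ⟨X₁, p, hX₁, hp, hsp, hhp, h⟩
    obtain ⟨X, d, ⟨e⟩, hadd, hzero, hsurj, hex, hsplit, hhsurj, hhex⟩ := ih h
    refine ⟨fun | 0 => ⟨N⟩ | 1 => X₁ | i + 2 => X (i + 1),
      fun | 0 => p | 1 => Submodule.subtype _ ∘ₗ e.toLinearMap ∘ₗ d 0 | i + 2 => d (i + 1),
      ⟨LinearEquiv.refl C _⟩, ?_, ?_, hp, ?_, ?_, hhp, ?_⟩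
    · rintro (_ | i) hi
      · exact hX₁
      · exact hadd i (by omega)
    · rintro (_ | _ | i) hi
      · omega
      · omega
      · exact hzero (i + 1) (by omega)
    · rintro (_ | _ | i) x
      · constructor
        · intro hx
          obtain ⟨y, hy⟩ := hsurj (e.symm ⟨x, hx⟩)
          exact ⟨y, (congrArg (fun z => (e z : X₁)) hy).trans
            (congrArg Subtype.val (e.apply_symm_apply ⟨x, hx⟩))⟩
        · rintro ⟨y, rfl⟩
          exact (e (d 0 y)).2
      · refine Iff.trans ?_ (hex 0 x)
        exact (Submodule.coe_eq_zero (x := e (d 0 x))).trans e.map_eq_zero_iff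
      · exact hex (i + 1) x
    · rintro (_ | _ | i)
      · exact hsp
      · obtain ⟨s, hs⟩ := hsplit 0
        -- the inclusion of `ker p` splits over `R` because `p` does
        obtain ⟨r, hr⟩ := hsp.exists_retraction
        refine ⟨s ∘ₗ (e.symm.restrictScalars R).toLinearMap ∘ₗ r, fun x => ?_⟩
        refine congrArg (fun z => (e z : X₁)) (?_ : d 0 (s (e.symm (r (e (d 0 x))))) = d 0 x)
        rw [hr, e.symm_apply_apply, hs]
      · exact hsplit (i + 1)
    · rintro (_ | _ | i) g
      · constructor
        · intro hg
          obtain ⟨f, hf⟩ := hhsurj (e.symm.toLinearMap ∘ₗ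
            g.codRestrict (LinearMap.ker p) (fun m => LinearMap.congr_fun hg m))
          refine ⟨f, LinearMap.ext fun m => ?_⟩
          exact (congrArg (fun z => (e z : X₁)) (LinearMap.congr_fun hf m)).trans
            (congrArg Subtype.val (e.apply_symm_apply _))
        · rintro ⟨f, rfl⟩
          exact LinearMap.ext fun m => (e (d 0 (f m))).2
      · refine Iff.trans ?_ (hhex 0 g)
        constructor
        · intro h
          refine LinearMap.ext fun m => ?_
          exact e.map_eq_zero_iff.1 (Submodule.coe_eq_zero.1 (LinearMap.congr_fun h m))
        · intro h
          refine LinearMap.ext fun m => ?_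
          exact Submodule.coe_eq_zero.2 (e.map_eq_zero_iff.2 (LinearMap.congr_fun h m))
      · exact hhex (i + 1) g

theorem hasAddResolution_iff {k : ℕ} {N : Type u} [AddCommGroup N] [Module R N] [Module C N]
    [IsScalarTower R C N] : HasAddResolution R C M N k ↔ AddRes R C M k N :=
  ⟨HasAddResolution.addRes, AddRes.hasAddResolution⟩

end Resolutions

/-! ### Relative injective dimension and projective resolutions of the dual -/

section ExtCat

open Abelian

universe w v u'

variable {C : Type u'} [Category.{v} C] [Abelian C] [HasExt.{w} C]

theorem subsingleton_ext_of_iso {N X Y : C} (e : X ≅ Y) {n : ℕ} (h : Subsingleton (Ext N X n)) :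
    Subsingleton (Ext N Y n) := by
  refine subsingleton_of_forall_eq 0 fun y => ?_
  have : (y.comp (Ext.mk₀ e.inv) (add_zero n)).comp (Ext.mk₀ e.hom) (add_zero n) = y := by
    simp
  rw [← this, h.elim (y.comp _ _) 0, Ext.zero_comp]

variable {S : ShortComplex C} (hS : S.ShortExact)

include hS

/-- Dimension shifting in the second variable of `Ext`. -/
theorem _root_.CategoryTheory.ShortComplex.ShortExact.subsingleton_ext_succ_iff_of_middle (N : C)
    (hY : ∀ i, Subsingleton (Ext N S.X₂ (i + 1))) (i : ℕ) :
    Subsingleton (Ext N S.X₁ (i + 2)) ↔ Subsingleton (Ext N S.X₃ (i + 1)) := by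
  constructor
  · intro h
    refine subsingleton_of_forall_eq 0 fun x => ?_
    obtain ⟨y, rfl⟩ := Ext.covariant_sequence_exact₃ N hS x rfl (h.elim _ _)
    rw [(hY i).elim y 0, Ext.zero_comp]
  · intro h
    refine subsingleton_of_forall_eq 0 fun x => ?_
    obtain ⟨y, rfl⟩ := Ext.covariant_sequence_exact₁ N hS x ((hY (i + 1)).elim _ _) rfl
    rw [h.elim y 0, Ext.zero_comp]

/-- Dimension shifting in the first variable of `Ext`. -/
theorem _root_.CategoryTheory.ShortComplex.ShortExact.subsingleton_ext_of_projective_middle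
    (hP : Projective S.X₂) (N : C) (i : ℕ) (h : Subsingleton (Ext S.X₁ N (i + 1))) :
    Subsingleton (Ext S.X₃ N (i + 2)) := by
  refine subsingleton_of_forall_eq 0 fun x => ?_
  obtain ⟨y, rfl⟩ := Ext.contravariant_sequence_exact₃ hS N x (Ext.eq_zero_of_projective _)
    (n₀ := i + 1) (by omega)
  rw [h.elim y 0, Ext.comp_zero]

theorem _root_.CategoryTheory.ShortComplex.ShortExact.subsingleton_ext_one_of_extension
    (hP : Projective S.X₂) (N : C) (h : ∀ φ : S.X₁ ⟶ N, ∃ ψ : S.X₂ ⟶ N, S.f ≫ ψ = φ) :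
    Subsingleton (Ext S.X₃ N 1) := by
  refine subsingleton_of_forall_eq 0 fun x => ?_
  obtain ⟨y, rfl⟩ := Ext.contravariant_sequence_exact₃ hS N x
    (Ext.eq_zero_of_projective _) (n₀ := 0) rfl
  obtain ⟨φ, rfl⟩ := (Ext.mk₀_bijective _ _).2 y
  obtain ⟨ψ, rfl⟩ := h φ
  rw [← Ext.mk₀_comp_mk₀, ← Ext.comp_assoc_of_second_deg_zero, hS.extClass_comp, Ext.zero_comp]

theorem _root_.CategoryTheory.ShortComplex.ShortExact.exists_retraction_of_subsingleton_ext
    (h : Subsingleton (Ext S.X₃ S.X₁ 1)) : ∃ r : S.X₂ ⟶ S.X₁, S.f ≫ r = 𝟙 S.X₁ := by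
  obtain ⟨y, hy⟩ := Ext.contravariant_sequence_exact₁ hS S.X₁ (Ext.mk₀ (𝟙 S.X₁)) (n₁ := 1) rfl
    (h.elim _ _)
  obtain ⟨r, rfl⟩ := (Ext.mk₀_bijective _ _).2 y
  rw [Ext.mk₀_comp_mk₀] at hy
  exact ⟨r, (Ext.mk₀_bijective _ _).1 hy⟩

end ExtCat

section Ext

open Abelian

variable {A : Type u} [Ring A] {X Y Z : Type u} [AddCommGroup X] [Module A X] [AddCommGroup Y]
  [Module A Y] [AddCommGroup Z] [Module A Z] {f : X →ₗ[A] Y} {g : Y →ₗ[A] Z}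

/-- A short exact sequence of modules, in the category of modules. -/
theorem moduleCat_shortExact (hf : Function.Injective f) (hfg : Function.Exact f g)
    (hg : Function.Surjective g) :
    (ShortComplex.moduleCatMk f g hfg.linearMap_comp_eq_zero).ShortExact where
  exact := (ShortComplex.ShortExact.moduleCat_exact_iff_function_exact _).2 hfg
  mono_f := (ModuleCat.mono_iff_injective _).2 hf
  epi_g := (ModuleCat.epi_iff_surjective _).2 hg

theorem subsingleton_ext_succ_iff (hf : Function.Injective f) (hfg : Function.Exact f g)
    (hg : Function.Surjective g) (N : ModuleCat.{u} A)
    (hY : ∀ i, Subsingleton (Ext N (ModuleCat.of A Y) (i + 1))) (i : ℕ) :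
    Subsingleton (Ext N (ModuleCat.of A X) (i + 2)) ↔
      Subsingleton (Ext N (ModuleCat.of A Z) (i + 1)) :=
  (moduleCat_shortExact hf hfg hg).subsingleton_ext_succ_iff_of_middle N hY i

theorem subsingleton_ext_of_projective [Module.Projective A Y]
    (hf : Function.Injective f) (hfg : Function.Exact f g)
    (hg : Function.Surjective g) (N : ModuleCat.{u} A) (i : ℕ)
    (h : Subsingleton (Ext (ModuleCat.of A X) N (i + 1))) :
    Subsingleton (Ext (ModuleCat.of A Z) N (i + 2)) :=
  (moduleCat_shortExact hf hfg hg).subsingleton_ext_of_projective_middle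
    ((IsProjective.iff_projective Y).1 inferInstance) N i h

theorem subsingleton_ext_one_of_extension [Module.Projective A Y]
    (hf : Function.Injective f) (hfg : Function.Exact f g)
    (hg : Function.Surjective g) {N : Type u} [AddCommGroup N] [Module A N]
    (h : ∀ φ : X →ₗ[A] N, ∃ ψ : Y →ₗ[A] N, ∀ x, ψ (f x) = φ x) :
    Subsingleton (Ext (ModuleCat.of A Z) (ModuleCat.of A N) 1) :=
  (moduleCat_shortExact hf hfg hg).subsingleton_ext_one_of_extension
    ((IsProjective.iff_projective Y).1 inferInstance) (ModuleCat.of A N) fun φ => by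
      obtain ⟨ψ, hψ⟩ := h φ.hom
      exact ⟨ModuleCat.ofHom ψ, ModuleCat.hom_ext (LinearMap.ext hψ)⟩

theorem exists_retraction_of_subsingleton_ext
    (hf : Function.Injective f) (hfg : Function.Exact f g) (hg : Function.Surjective g)
    (h : Subsingleton (Ext (ModuleCat.of A Z) (ModuleCat.of A X) 1)) :
    ∃ r : Y →ₗ[A] X, ∀ x, r (f x) = x := by
  obtain ⟨r, hr⟩ := (moduleCat_shortExact hf hfg hg).exists_retraction_of_subsingleton_ext h
  exact ⟨r.hom, fun x => LinearMap.congr_fun (congrArg ModuleCat.Hom.hom hr) x⟩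

end Ext

section RelInjDim

variable {R : Type u} [CommRing R] {A : Type u} [Ring A] [Algebra R A]

/-- The dual of a finitely generated projective right module is injective relative to the
inclusions of left modules that split over `R`. -/
theorem exists_extension_stdDual {Q : Type u} [AddCommGroup Q] [Module R Q] [Module Aᵐᵒᵖ Q]
    [IsScalarTower R Aᵐᵒᵖ Q] (hQ : InAdd Aᵐᵒᵖ A Q) {Y : Type u} [AddCommGroup Y] [Module R Y]
    [Module A Y] [IsScalarTower R A Y] (X : Submodule A Y) (r : Y →ₗ[R] X) (hr : ∀ x : X, r x = x)
    (φ : X →ₗ[A] StdDual R Q) : ∃ ψ : Y →ₗ[A] StdDual R Q, ∀ x : X, ψ x = φ x := by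
  obtain ⟨k, i, p, hpi⟩ := inAdd_iff.1 hQ
  refine ⟨{
    toFun y := StdDual.of
      { toFun q := ∑ j, φ (r (i j q • y)) (p j 1)
        map_add' q q' := by simp [add_smul, Finset.sum_add_distrib]
        map_smul' c q := by
          simp [LinearMap.map_smul_of_tower, Finset.mul_sum] }
    map_add' y y' := StdDual.ext fun q => by simp [Finset.sum_add_distrib]
    map_smul' a y := StdDual.ext fun q => by
      rw [RingHom.id_apply, smul_apply]
      simp [mul_smul] }, fun x => StdDual.ext fun q => ?_⟩
  change ∑ j, φ (r (i j q • (x : Y))) (p j 1) = φ x q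
  have : ∀ j, φ (r (i j q • (x : Y))) (p j 1) = φ x (p j (i j q)) := fun j => by
    rw [← Submodule.coe_smul, hr, map_smul, smul_apply, ← map_smul, op_smul_eq_mul, one_mul]
  rw [Finset.sum_congr rfl fun j _ => this j, ← StdDual.map_sum', hpi]

variable (hA : IsProjNoethAlg R A)

include hA in
/-- Every module which is finitely generated projective over `R` is a quotient of a finitely
generated free `A`-module. -/
theorem exists_free_cover (N : Type u) [AddCommGroup N] [Module R N] [Module A N]
    [IsScalarTower R A N] (hN : IsRProj R N) :
    ∃ (k : ℕ) (p : (Fin k → A) →ₗ[A] N), Function.Surjective p ∧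
      IsRProj R (LinearMap.ker p) ∧
      ∃ r : (Fin k → A) →ₗ[R] LinearMap.ker p, ∀ x : LinearMap.ker p, r x = x := by
  have := hN.1
  have : Module.Finite A N := Module.Finite.of_restrictScalars_finite R A N
  obtain ⟨k, p, hp⟩ := Module.Finite.exists_fin' A N
  have hs : IsSplitOver R p := hN.isSplitOver hp
  exact ⟨k, p, hp, (IsRProj.pi hA k).ker hs, hs.exists_retraction⟩

include hA in
theorem subsingleton_ext_stdDual {Q : Type u} [AddCommGroup Q] [Module R Q] [Module Aᵐᵒᵖ Q]
    [IsScalarTower R Aᵐᵒᵖ Q] (hQ : InAdd Aᵐᵒᵖ A Q) (i : ℕ) :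
    ∀ (N : Type u) [AddCommGroup N] [Module R N] [Module A N] [IsScalarTower R A N],
      IsRProj R N →
      Subsingleton (Abelian.Ext (ModuleCat.of A N) (ModuleCat.of A (StdDual R Q)) (i + 1)) := by
  induction i with
  | zero =>
    intro N _ _ _ _ hN
    obtain ⟨k, p, hp, -, r, hr⟩ := exists_free_cover hA N hN
    exact subsingleton_ext_one_of_extension (Submodule.injective_subtype _)
      (LinearMap.exact_subtype_ker_map p) hp fun φ => exists_extension_stdDual hQ _ r hr φ
  | succ i ih =>
    intro N _ _ _ _ hN
    obtain ⟨k, p, hp, hker, -⟩ := exists_free_cover hA N hN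
    exact subsingleton_ext_of_projective (Submodule.injective_subtype _)
      (LinearMap.exact_subtype_ker_map p) hp _ i (ih _ hker)

section

variable {L Q : Type u} [AddCommGroup L] [Module R L] [Module Aᵐᵒᵖ L] [IsScalarTower R Aᵐᵒᵖ L]
  [AddCommGroup Q] [Module R Q] [Module Aᵐᵒᵖ Q] [IsScalarTower R Aᵐᵒᵖ Q]
  (hL : IsRProj R L) {p : Q →ₗ[Aᵐᵒᵖ] L} (hp : Function.Surjective p)

include hp in
theorem transposeRight_injective :
    Function.Injective (transposeRight (R := R) p) := fun f g h => StdDual.ext fun l => by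
  obtain ⟨q, rfl⟩ := hp l
  exact DFunLike.congr_fun h q

include hL hp in
theorem transposeRight_surjective :
    Function.Surjective (transposeRight (R := R) (LinearMap.ker p).subtype) := fun f => by
  obtain ⟨r, hr⟩ := (hL.isSplitOver hp).exists_retraction
  exact ⟨StdDual.of (f.toLin ∘ₗ r), StdDual.ext fun x => congrArg f (hr x)⟩

include hL hp in
theorem transposeRight_exact :
    Function.Exact (transposeRight (R := R) p)
      (transposeRight (R := R) (LinearMap.ker p).subtype) := fun f => by
  constructor
  · intro h
    have hf : ∀ x, p x = 0 → f x = 0 := fun x hx => DFunLike.congr_fun h ⟨x, hx⟩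
    obtain ⟨s, hs⟩ := hL.exists_section (p.restrictScalars R) hp
    refine ⟨StdDual.of (f.toLin ∘ₗ s), StdDual.ext fun x => ?_⟩
    have := hf (s (p x) - x) (by rw [map_sub]; exact sub_eq_zero.2 (hs (p x)))
    rw [map_sub, sub_eq_zero] at this
    exact this
  · rintro ⟨g, rfl⟩
    refine StdDual.ext fun x => ?_
    have : p x = 0 := x.2
    simp [this]

end

include hA in
/-- For a right `A`-module `L` which is finitely generated projective over `R`, the relative
injective dimension of `D L` is the length of a shortest projective resolution of `L`. -/
theorem relInjDimLE_stdDual_iff (k : ℕ) :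
    ∀ (L : Type u) [AddCommGroup L] [Module R L] [Module Aᵐᵒᵖ L] [IsScalarTower R Aᵐᵒᵖ L],
      IsRProj R L → (RelInjDimLE R A (StdDual R L) k ↔ ProjRes R A k L) := by
  have hfin : Module.Finite R A := hA.1
  have hAlg : ∀ N : AlgMod R A, Module.Finite A N → Module.Projective R N → IsRProj R N :=
    fun N _ h => ⟨Module.Finite.trans A N, h⟩
  have hAop : IsProjNoethAlg R Aᵐᵒᵖ := IsRProj.of_equiv hA (opLinearEquiv R)
  have hfree : ∀ k, InAdd Aᵐᵒᵖ A (Fin k → Aᵐᵒᵖ) := fun k => by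
    let e : A ≃ₗ[Aᵐᵒᵖ] Aᵐᵒᵖ := ⟨⟨⟨op, fun _ _ => rfl⟩, fun _ _ => rfl⟩, unop, fun _ => rfl,
      fun _ => rfl⟩
    exact (InAdd.pi k).congr (LinearEquiv.piCongrRight fun _ => e)
  induction k with
  | zero =>
    intro L _ _ _ _ hL
    refine ⟨fun h => ?_, fun h N hN hN' => subsingleton_ext_stdDual hA h 0 N (hAlg N hN hN')⟩
    obtain ⟨k, p, hp, hker, -⟩ := exists_free_cover hAop L hL
    have hD := hker.stdDual
    have := hD.1
    obtain ⟨r, hr⟩ := exists_retraction_of_subsingleton_ext (transposeRight_injective hp)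
      (transposeRight_exact hL hp) (transposeRight_surjective hL hp)
      (h ⟨StdDual R (LinearMap.ker p)⟩ (Module.Finite.of_restrictScalars_finite R A _) hD.2)
    -- the transpose of the retraction is a section of `p`
    have hF : IsRProj R (Fin k → Aᵐᵒᵖ) := IsRProj.pi hAop k
    let s : L →ₗ[Aᵐᵒᵖ] (Fin k → Aᵐᵒᵖ) :=
      (evalEquiv hF).symm.toLinearMap ∘ₗ transposeLeft r ∘ₗ (evalEquiv hL).toLinearMap
    have hs : p ∘ₗ s = LinearMap.id := LinearMap.ext fun l => by
      refine StdDual.eq_of_forall hL fun f => ?_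
      have h1 : evalEquiv (C := Aᵐᵒᵖ) hF (s l) = transposeLeft r (evalEquiv hL l) :=
        (evalEquiv hF).apply_symm_apply _
      have h2 := DFunLike.congr_fun h1 (transposeRight p f)
      rw [transposeLeft_apply, hr] at h2
      exact h2
    obtain ⟨m, i, q, hqi⟩ := hfree k
    refine ⟨m, i ∘ₗ s, p ∘ₗ q, ?_⟩
    rw [LinearMap.comp_assoc, ← LinearMap.comp_assoc s, hqi, LinearMap.id_comp, hs]
  | succ k ih =>
    intro L _ _ _ _ hL
    have key : ∀ (Q : Type u) [AddCommGroup Q] [Module R Q] [Module Aᵐᵒᵖ Q]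
        [IsScalarTower R Aᵐᵒᵖ Q] (p : Q →ₗ[Aᵐᵒᵖ] L), InAdd Aᵐᵒᵖ A Q → Function.Surjective p →
        (RelInjDimLE R A (StdDual R L) (k + 1) ↔ ProjRes R A k (LinearMap.ker p)) := by
      intro Q _ _ _ _ p hQ hp
      rw [← ih _ ((hQ.isRProj hA).ker (hL.isSplitOver hp))]
      refine forall_congr' fun N => forall_congr' fun hN => forall_congr' fun hN' => ?_
      exact subsingleton_ext_succ_iff (transposeRight_injective hp)
        (transposeRight_exact hL hp) (transposeRight_surjective hL hp) _
        (fun i => subsingleton_ext_stdDual hA hQ i N (hAlg N hN hN')) k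
    constructor
    · intro h
      obtain ⟨m, p, hp, -⟩ := exists_free_cover hAop L hL
      exact ⟨⟨Fin m → Aᵐᵒᵖ⟩, p, hfree m, hp, (key _ p (hfree m) hp).1 h⟩
    · rintro ⟨Q, p, hQ, hp, h⟩
      exact (key _ p hQ hp).2 h

include hA in
theorem relInjDimLE_iff {M : Type u} [AddCommGroup M] [Module R M] [Module A M]
    [IsScalarTower R A M] (hM : IsRProj R M) (k : ℕ) :
    RelInjDimLE R A M k ↔ ProjRes R A k (StdDual R M) := by
  rw [← relInjDimLE_stdDual_iff hA k _ hM.stdDual]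
  refine forall_congr' fun N => forall_congr' fun _ => forall_congr' fun _ => ?_
  let e : ModuleCat.of A M ≅ ModuleCat.of A (StdDual R (StdDual R M)) :=
    (evalEquiv (C := A) hM).toModuleIso
  exact ⟨subsingleton_ext_of_iso e, subsingleton_ext_of_iso e.symm⟩

end RelInjDim

/-! ### Resolutions over the two endomorphism rings of a bimodule -/

section Bimodule

/-- Two rings `S` and `T` act on `M` such that the action of `S` identifies `S` with `End_T(M)`. -/
structure IsFullEnd (S T M : Type u) [Ring S] [Ring T] [AddCommGroup M] [Module S M]
    [Module T M] : Prop where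
  faithful : ∀ a : S, (∀ m : M, a • m = 0) → a = 0
  full : ∀ h : M →ₗ[T] M, ∃ a : S, ∀ m, a • m = h m

namespace IsFullEnd

variable {S T M : Type u} [Ring S] [Ring T] [AddCommGroup M] [Module S M] [Module T M]

theorem eq_of_smul (h : IsFullEnd S T M) {a a' : S} (haa' : ∀ m : M, a • m = a' • m) : a = a' :=
  sub_eq_zero.1 (h.faithful _ fun m => by rw [sub_smul, haa', sub_self])

/-- The element of `S` that acts as a given endomorphism of `M`. -/
noncomputable def coeff (h : IsFullEnd S T M) (f : M →ₗ[T] M) : S := (h.full f).choose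

@[simp] theorem coeff_smul (h : IsFullEnd S T M) (f : M →ₗ[T] M) (m : M) :
    h.coeff f • m = f m := (h.full f).choose_spec m

end IsFullEnd

variable {R : Type u} [CommRing R] {A : Type u} [Ring A] {B : Type u} [Ring B]
  [Algebra R B] {M : Type u} [AddCommGroup M] [Module A M] [Module Bᵐᵒᵖ M]

variable (R A B M) in
/-- An `A`-balanced pairing `L × M → N`, `B`-linear in the second variable; equivalently a map
`L → Hom_B(M, N)` of right `A`-modules, or a map `L ⊗_A M → N` of right `B`-modules. -/
structure BalancedPairing (L N : Type u) [AddCommGroup L] [Module R L] [Module Aᵐᵒᵖ L]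
    [AddCommGroup N] [Module R N] [Module Bᵐᵒᵖ N] [IsScalarTower R Bᵐᵒᵖ N] where
  /-- the map `L → Hom_B(M, N)` -/
  toHom : L →ₗ[R] M →ₗ[Bᵐᵒᵖ] N
  balanced : ∀ (a : A) (l : L) (m : M), toHom (op a • l) m = toHom l (a • m)

namespace BalancedPairing

section

variable {L N : Type u} [AddCommGroup L] [Module R L] [Module Aᵐᵒᵖ L]
  [AddCommGroup N] [Module R N] [Module Bᵐᵒᵖ N] [IsScalarTower R Bᵐᵒᵖ N]
  (θ : BalancedPairing R A B M L N)

/-- The map `L ⊗_A M → N`. -/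
def counit : TensorOver R A L M →ₗ[R] N :=
  TensorOver.lift (fun l m => θ.toHom l m) (fun l l' m => by rw [map_add, LinearMap.add_apply])
    (fun l m m' => map_add _ m m') (fun r l m => by rw [map_smul, LinearMap.smul_apply])
    θ.balanced

@[simp] theorem counit_tmul (l : L) (m : M) : θ.counit (TensorOver.tmul R A l m) = θ.toHom l m :=
  rfl

/-- If `N ∈ add M`, then `Hom_B(M, N)` is projective over `A = End_B(M)`. -/
theorem inAdd_of_inAdd (hE : IsFullEnd A Bᵐᵒᵖ M) (hθ : Function.Bijective θ.toHom)
    (hN : InAdd Bᵐᵒᵖ M N) : InAdd Aᵐᵒᵖ A L := by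
  obtain ⟨k, i, p, hpi⟩ := inAdd_iff.1 hN
  choose l hl using fun j => hθ.2 (p j)
  refine inAdd_iff.2 ⟨k, fun j =>
    { toFun x := hE.coeff (i j ∘ₗ θ.toHom x)
      map_add' x y := hE.eq_of_smul fun m => by simp [add_smul]
      map_smul' a x := hE.eq_of_smul fun m => by
        induction a with | _ a => simp [mul_smul, θ.balanced] },
    fun j =>
    { toFun a := op a • l j
      map_add' a b := add_smul (op a) (op b) (l j)
      map_smul' a b := mul_smul a (op b) (l j) }, fun x => hθ.1 (LinearMap.ext fun m => ?_)⟩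
  simp [θ.balanced, hl, hpi]

theorem counit_bijective_of_inAdd (hE : IsFullEnd A Bᵐᵒᵖ M) (hθ : Function.Bijective θ.toHom)
    (hN : InAdd Bᵐᵒᵖ M N) : Function.Bijective θ.counit := by
  obtain ⟨k, i, p, hpi⟩ := inAdd_iff.1 hN
  choose l hl using fun j => hθ.2 (p j)
  have key : ∀ t, t = ∑ j, TensorOver.tmul R A (l j) (i j (θ.counit t)) := by
    intro t
    induction t using TensorOver.induction_on with
    | h0 => simp
    | h1 x m =>
      have : x = ∑ j, op (hE.coeff (i j ∘ₗ θ.toHom x)) • l j :=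
        hθ.1 (LinearMap.ext fun m => by simp [θ.balanced, hl, hpi])
      conv_lhs => rw [this, TensorOver.sum_tmul]
      simp [TensorOver.op_smul_tmul]
    | h2 s t hs ht =>
      conv_lhs => rw [hs, ht]
      simp [TensorOver.tmul_add, Finset.sum_add_distrib]
  constructor
  · rw [injective_iff_map_eq_zero]
    intro t ht
    rw [key t, ht]
    simp
  · intro n
    exact ⟨∑ j, TensorOver.tmul R A (l j) (i j n), by simp [hl, hpi]⟩

variable [Algebra R A]

variable {L₀ N₀ : Type u} [AddCommGroup L₀] [Module R L₀] [Module Aᵐᵒᵖ L₀] [IsScalarTower R Aᵐᵒᵖ L₀]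
  [AddCommGroup N₀] [Module R N₀] [Module Bᵐᵒᵖ N₀] [IsScalarTower R Bᵐᵒᵖ N₀]
  (θ₀ : BalancedPairing R A B M L₀ N₀) {q : L₀ →ₗ[Aᵐᵒᵖ] L} {p : N₀ →ₗ[Bᵐᵒᵖ] N}
  (hqp : ∀ l m, θ.toHom (q l) m = p (θ₀.toHom l m))

/-- The pairing between the kernels of a compatible pair of maps. -/
def ker : BalancedPairing R A B M (LinearMap.ker q) (LinearMap.ker p) where
  toHom :=
    { toFun l := (θ₀.toHom l).codRestrict (LinearMap.ker p) fun m => by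
        have : q l = 0 := l.2
        rw [LinearMap.mem_ker, ← hqp, this, map_zero, LinearMap.zero_apply]
      map_add' l l' := LinearMap.ext fun m => Subtype.ext (by simp)
      map_smul' r l := LinearMap.ext fun m => Subtype.ext (by
        change θ₀.toHom (r • (l : L₀)) m = r • θ₀.toHom (l : L₀) m
        rw [map_smul, LinearMap.smul_apply]) }
  balanced a l m := Subtype.ext (θ₀.balanced a l m)

theorem ker_toHom_bijective (h₀ : Function.Bijective θ₀.toHom) (h : Function.Injective θ.toHom) :
    Function.Bijective (θ.ker θ₀ hqp).toHom := by
  constructor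
  · intro l l' hll'
    refine Subtype.ext (h₀.1 (LinearMap.ext fun m => ?_))
    exact congrArg Subtype.val (LinearMap.congr_fun hll' m)
  · intro g
    obtain ⟨l, hl⟩ := h₀.2 ((LinearMap.ker p).subtype ∘ₗ g)
    have hm : ∀ m, θ₀.toHom l m = g m := LinearMap.congr_fun hl
    refine ⟨⟨l, h (LinearMap.ext fun m => ?_)⟩, LinearMap.ext fun m => Subtype.ext (hm m)⟩
    rw [hqp, hm, map_zero, LinearMap.zero_apply]
    exact (g m).2

theorem coe_counit_ker (t : TensorOver R A (LinearMap.ker q) M) :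
    ((θ.ker θ₀ hqp).counit t : N₀) =
      θ₀.counit (TensorOver.rmap R M (LinearMap.ker q).subtype t) := by
  have : ((LinearMap.ker p).subtype.restrictScalars R) ∘ₗ (θ.ker θ₀ hqp).counit =
      θ₀.counit ∘ₗ TensorOver.rmap R M (LinearMap.ker q).subtype :=
    TensorOver.hom_ext fun l m => rfl
  exact LinearMap.congr_fun this t

include hqp in
theorem counit_rmap [IsScalarTower R Aᵐᵒᵖ L] (t : TensorOver R A L₀ M) :
    θ.counit (TensorOver.rmap R M q t) = p (θ₀.counit t) := by
  have : θ.counit ∘ₗ TensorOver.rmap R M q = (p.restrictScalars R) ∘ₗ θ₀.counit :=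
    TensorOver.hom_ext hqp
  exact LinearMap.congr_fun this t

end

end BalancedPairing


variable (A M) in
/-- The action of `b` on the bimodule `M`, as an `A`-linear map. -/
def rightMul {T : Type u} [Ring T] [Module T M] [SMulCommClass A T M] (b : T) : M →ₗ[A] M where
  toFun m := b • m
  map_add' := smul_add b
  map_smul' a m := (smul_comm a b m).symm

theorem BalancedPairing.counit_rightMul {L N : Type u} [AddCommGroup L] [Module R L]
    [Module Aᵐᵒᵖ L] [AddCommGroup N] [Module R N] [Module Bᵐᵒᵖ N] [IsScalarTower R Bᵐᵒᵖ N]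
    [SMulCommClass A Bᵐᵒᵖ M]
    (θ : BalancedPairing R A B M L N) (b : Bᵐᵒᵖ) (t : TensorOver R A L M) :
    θ.counit (tensorMap R A L (rightMul A M b) t) = b • θ.counit t := by
  induction t using TensorOver.induction_on with
  | h0 => simp
  | h1 l m => exact map_smul (θ.toHom l) b m
  | h2 s t hs ht => rw [map_add, map_add, hs, ht, map_add, smul_add]

variable [Algebra R A] [Module R M] [IsScalarTower R A M]

theorem TensorOver.coord_rightMul {T : Type u} [Ring T] [Module T M]
    [SMulCommClass A T M] {Q : Type u} [AddCommGroup Q] [Module R Q] [Module Aᵐᵒᵖ Q]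
    [IsScalarTower R Aᵐᵒᵖ Q] (φ : Q →ₗ[Aᵐᵒᵖ] A) (b : T) (t : TensorOver R A Q M) :
    TensorOver.coord φ (tensorMap R A Q (rightMul A M b) t) = b • TensorOver.coord φ t := by
  induction t using TensorOver.induction_on with
  | h0 => simp
  | h1 l m => exact smul_comm _ _ _
  | h2 s t hs ht => simp [hs, ht]

variable [SMulCommClass A Bᵐᵒᵖ M]

/-- If `L` is projective over `A`, then `L ⊗_A M ∈ add M`. -/
theorem BalancedPairing.inAdd_of_counit_bijective {L N : Type u} [AddCommGroup L] [Module R L] [Module Aᵐᵒᵖ L]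
    [IsScalarTower R Aᵐᵒᵖ L] [AddCommGroup N] [Module R N] [Module Bᵐᵒᵖ N] [IsScalarTower R Bᵐᵒᵖ N]
    (θ : BalancedPairing R A B M L N) (hc : Function.Bijective θ.counit) (hL : InAdd Aᵐᵒᵖ A L) :
    InAdd Bᵐᵒᵖ M N := by
  obtain ⟨k, i, p, hpi⟩ := inAdd_iff.1 hL
  let e := LinearEquiv.ofBijective θ.counit hc
  have he : ∀ t, e.symm (θ.counit t) = t := e.symm_apply_apply
  refine inAdd_iff.2 ⟨k, fun j =>
    { toFun n := TensorOver.coord (R := R) (i j) (e.symm n)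
      map_add' n n' := by rw [map_add, map_add]
      map_smul' b n := by
        obtain ⟨t, rfl⟩ := hc.2 n
        rw [he, RingHom.id_apply, ← TensorOver.coord_rightMul, ← θ.counit_rightMul, he] },
    fun j => θ.toHom (p j 1), fun n => ?_⟩
  obtain ⟨t, rfl⟩ := hc.2 n
  have := congrArg θ.counit (TensorOver.sum_tmul_coord (R := R) hpi t)
  rw [map_sum] at this
  refine Eq.trans (Finset.sum_congr rfl fun j _ => ?_) this
  rw [counit_tmul]
  exact congrArg (fun t => θ.toHom (p j 1) (TensorOver.coord (i j) t)) (he t)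

variable [IsScalarTower R Bᵐᵒᵖ M]

section Functors

/-- The right `A`-module structure `(h a)(m) = h(a m)` on `Hom_B(M, N)`. -/
@[reducible] def homModule (A : Type u) [Ring A] [Module A M] [SMulCommClass A Bᵐᵒᵖ M] (N : Type u)
    [AddCommGroup N] [Module Bᵐᵒᵖ N] : Module Aᵐᵒᵖ (M →ₗ[Bᵐᵒᵖ] N) where
  smul a h :=
    { toFun m := h (unop a • m)
      map_add' m m' := by rw [smul_add, map_add]
      map_smul' b m := by rw [smul_comm, map_smul]; rfl }
  one_smul h := LinearMap.ext fun m => congrArg h (one_smul A m)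
  mul_smul a a' h := LinearMap.ext fun m => congrArg h (mul_smul (unop a') (unop a) m)
  smul_zero _ := rfl
  smul_add _ _ _ := rfl
  add_smul a a' h := LinearMap.ext fun m =>
    (congrArg h (add_smul (unop a) (unop a') m)).trans (map_add h _ _)
  zero_smul h := LinearMap.ext fun m => (congrArg h (zero_smul A m)).trans (map_zero h)

variable (M) in
/-- `Hom_B(M, N)` as a right `A`-module. -/
def homMod (N : AlgMod R Bᵐᵒᵖ) : AlgMod R Aᵐᵒᵖ where
  carrier := M →ₗ[Bᵐᵒᵖ] N
  module := homModule A N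
  isScalarTower :=
    let _ := homModule (B := B) (M := M) A N
    ⟨fun r a h => LinearMap.ext fun m =>
      (congrArg h (smul_assoc r (unop a) m)).trans (LinearMap.map_smul_of_tower h r _)⟩

/-- The evaluation pairing `Hom_B(M, N) × M → N`. -/
def homPairing (N : AlgMod R Bᵐᵒᵖ) : BalancedPairing R A B M (homMod (A := A) M N) N where
  toHom := LinearMap.id (R := R) (M := M →ₗ[Bᵐᵒᵖ] N)
  balanced _ _ _ := rfl

/-- The right `B`-module structure of `L ⊗_A M`. -/
@[reducible] def tensorModule (B : Type u) [Ring B] [Module Bᵐᵒᵖ M] [SMulCommClass A Bᵐᵒᵖ M]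
    (L : Type u) [AddCommGroup L] [Module R L] [Module Aᵐᵒᵖ L] :
    Module Bᵐᵒᵖ (TensorOver R A L M) where
  smul b t := tensorMap R A L (rightMul A M b) t
  one_smul t := by
    change tensorMap R A L (rightMul A M 1) t = t
    rw [show rightMul A M (1 : Bᵐᵒᵖ) = LinearMap.id from
      LinearMap.ext fun m => one_smul _ m, tensorMap_id]
    rfl
  mul_smul b b' t := by
    change tensorMap R A L (rightMul A M (b * b')) t = tensorMap R A L (rightMul A M b)
      (tensorMap R A L (rightMul A M b') t)
    rw [← LinearMap.comp_apply, ← tensorMap_comp]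
    exact congrArg (fun f => tensorMap R A L f t) (LinearMap.ext fun m => mul_smul b b' m)
  smul_zero b := map_zero (tensorMap R A L (rightMul A M b))
  smul_add b := map_add (tensorMap R A L (rightMul A M b))
  add_smul b b' t := by
    change tensorMap R A L (rightMul A M (b + b')) t = tensorMap R A L (rightMul A M b) t +
      tensorMap R A L (rightMul A M b') t
    rw [← LinearMap.add_apply, ← tensorMap_add]
    exact congrArg (fun f => tensorMap R A L f t) (LinearMap.ext fun m => add_smul b b' m)
  zero_smul t := by
    change tensorMap R A L (rightMul A M (0 : Bᵐᵒᵖ)) t = 0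
    induction t using TensorOver.induction_on with
    | h0 => simp
    | h1 l m => simp [rightMul]
    | h2 s t hs ht => simp [hs, ht]

variable (B M) in
/-- `L ⊗_A M` as a right `B`-module. -/
def tensorMod (L : AlgMod R Aᵐᵒᵖ) : AlgMod R Bᵐᵒᵖ where
  carrier := TensorOver R A L M
  module := tensorModule B L
  isScalarTower :=
    let _ := tensorModule (R := R) (A := A) (M := M) B L
    ⟨fun r b t => by
      change tensorMap R A L (rightMul A M (r • b)) t = r • tensorMap R A L (rightMul A M b) t
      induction t using TensorOver.induction_on with
      | h0 => simp
      | h1 l m =>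
        rw [TensorOver.tensorMap_tmul, TensorOver.tensorMap_tmul, ← TensorOver.base_smul_tmul]
        change TensorOver.tmul R A l ((r • b) • m) = TensorOver.tmul R A (r • l) (b • m)
        rw [← algebraMap_smul Aᵐᵒᵖ r l, smul_assoc, ← algebraMap_smul A r (b • m)]
        exact (TensorOver.op_smul_tmul (algebraMap R A r) l (b • m)).symm
      | h2 s t hs ht => rw [map_add, hs, ht, map_add, smul_add]⟩

/-- The pairing `L × M → L ⊗_A M`. -/
def tensorPairing (L : AlgMod R Aᵐᵒᵖ) : BalancedPairing R A B M L (tensorMod B M L) where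
  toHom :=
    { toFun l :=
        { toFun m := TensorOver.tmul R A l m
          map_add' := TensorOver.tmul_add l
          map_smul' _ _ := rfl }
      map_add' l l' := LinearMap.ext fun m => TensorOver.add_tmul l l' m
      map_smul' _ _ := rfl }
  balanced a l m := TensorOver.op_smul_tmul a l m

theorem counit_tensorPairing (L : AlgMod R Aᵐᵒᵖ) (t : TensorOver R A L M) :
    (tensorPairing (B := B) (M := M) L).counit t = t := by
  have : (tensorPairing (B := B) (M := M) L).counit = LinearMap.id (M := TensorOver R A L M) :=
    TensorOver.hom_ext fun l m => rfl
  exact LinearMap.congr_fun this t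

/-- For `Q` projective over `A = End_B(M)`, the unit `Q → Hom_B(M, Q ⊗_A M)` is bijective. -/
theorem tensorPairing_bijective (hE : IsFullEnd A Bᵐᵒᵖ M) (Q : AlgMod R Aᵐᵒᵖ)
    (hQ : InAdd Aᵐᵒᵖ A Q) : Function.Bijective (tensorPairing (B := B) (M := M) Q).toHom := by
  obtain ⟨k, i, p, hpi⟩ := inAdd_iff.1 hQ
  constructor
  · rw [injective_iff_map_eq_zero]
    intro q hq
    have hi : ∀ j, i j q = 0 := fun j => hE.faithful _ fun m => by
      have := congrArg (TensorOver.coord (R := R) (i j)) (LinearMap.congr_fun hq m)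
      rw [LinearMap.zero_apply] at this
      exact this.trans (map_zero _)
    rw [← hpi q]
    simp [hi]
  · intro h
    -- the `j`-th coordinate of `h`, an endomorphism of `M`
    let c : Fin k → M →ₗ[Bᵐᵒᵖ] M := fun j =>
      { toFun m := TensorOver.coord (R := R) (i j) (show TensorOver R A Q M from h m)
        map_add' m m' := by
          rw [← map_add]
          exact congrArg (TensorOver.coord (i j)) (map_add h m m')
        map_smul' b m := by
          exact (congrArg (TensorOver.coord (i j)) (map_smul h b m)).trans
            (TensorOver.coord_rightMul (i j) b (h m)) }
    refine ⟨∑ j, p j (hE.coeff (c j)), LinearMap.ext fun m => ?_⟩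
    have hexp := TensorOver.sum_tmul_coord (R := R) hpi (show TensorOver R A Q M from h m)
    refine Eq.trans ?_ hexp
    change TensorOver.tmul R A (∑ j, p j (hE.coeff (c j))) m = _
    rw [TensorOver.sum_tmul]
    refine Finset.sum_congr rfl fun j _ => ?_
    have : p j (hE.coeff (c j)) = op (hE.coeff (c j)) • p j 1 := by
      rw [← map_smul, op_smul_eq_mul, one_mul]
    rw [this, TensorOver.op_smul_tmul, hE.coeff_smul]
    rfl

end Functors

namespace BalancedPairing

/-- A resolution of `N` in `add M` yields a projective resolution of `Hom_B(M, N)`; tensoring the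
latter with `M` gives back the former, so that `Tor` vanishes. -/
theorem projRes_of_addRes (hE : IsFullEnd A Bᵐᵒᵖ M) (P : ModuleResolution A M) (k : ℕ) :
    ∀ {L N : Type u} [AddCommGroup L] [Module R L] [Module Aᵐᵒᵖ L] [IsScalarTower R Aᵐᵒᵖ L]
      [AddCommGroup N] [Module R N] [Module Bᵐᵒᵖ N] [IsScalarTower R Bᵐᵒᵖ N]
      (θ : BalancedPairing R A B M L N), Function.Bijective θ.toHom → AddRes R Bᵐᵒᵖ M k N →
      ProjRes R A k L ∧ Function.Bijective θ.counit ∧ ∀ i, P.TorVanish R L i := by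
  induction k with
  | zero =>
    intro L N _ _ _ _ _ _ _ _ θ hθ hN
    have hL := θ.inAdd_of_inAdd hE hθ hN
    exact ⟨hL, θ.counit_bijective_of_inAdd hE hθ hN, P.torVanish_of_inAdd hL⟩
  | succ k ih =>
    rintro L N _ _ _ _ _ _ _ _ θ hθ ⟨N₀, p, hN₀, hp, -, hhp, hres⟩
    let e := LinearEquiv.ofBijective θ.toHom hθ
    have he : ∀ g m, θ.toHom (e.symm g) m = g m := fun g m =>
      LinearMap.congr_fun (e.apply_symm_apply g) m
    let L₀ : AlgMod R Aᵐᵒᵖ := homMod (A := A) M N₀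
    let θ₀ : BalancedPairing R A B M L₀ N₀ := homPairing N₀
    have hθ₀ : Function.Bijective θ₀.toHom := Function.bijective_id
    let q : L₀ →ₗ[Aᵐᵒᵖ] L :=
      { toFun h := e.symm (p ∘ₗ θ₀.toHom h)
        map_add' h h' := by rw [map_add, LinearMap.comp_add, map_add]
        map_smul' a h := hθ.1 (LinearMap.ext fun m => by
          induction a with | _ a => simp [he, θ.balanced, θ₀.balanced]) }
    have hqp : ∀ l m, θ.toHom (q l) m = p (θ₀.toHom l m) := fun l m => he _ m
    have hq : Function.Surjective q := fun l => by
      obtain ⟨h, hh⟩ := hhp (θ.toHom l)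
      obtain ⟨h, rfl⟩ := hθ₀.2 h
      exact ⟨h, hθ.1 (LinearMap.ext fun m => (hqp h m).trans (LinearMap.congr_fun hh m))⟩
    have hL₀ : InAdd Aᵐᵒᵖ A L₀ := θ₀.inAdd_of_inAdd hE hθ₀ hN₀
    have hc₀ := θ₀.counit_bijective_of_inAdd hE hθ₀ hN₀
    obtain ⟨hres', hc', htor'⟩ :=
      ih (θ.ker θ₀ hqp) (θ.ker_toHom_bijective θ₀ hqp hθ₀ hθ.1) hres
    have hιq := LinearMap.exact_subtype_ker_map q
    have hι : Function.Injective (TensorOver.rmap R M (LinearMap.ker q).subtype) := by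
      rw [← hc₀.1.of_comp_iff, ← LinearMap.coe_comp]
      intro s t hst
      refine hc'.1 (Subtype.ext ?_)
      rw [coe_counit_ker, coe_counit_ker]
      exact hst
    refine ⟨⟨L₀, q, hL₀, hq, hres'⟩, ⟨?_, ?_⟩, ?_⟩
    · rw [injective_iff_map_eq_zero]
      intro t ht
      obtain ⟨t, rfl⟩ := TensorOver.rmap_surjective hq t
      rw [θ.counit_rmap θ₀ hqp] at ht
      obtain ⟨s, hs⟩ := hc'.2 ⟨θ₀.counit t, ht⟩
      have hst : TensorOver.rmap R M (LinearMap.ker q).subtype s = t :=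
        hc₀.1 (by rw [← coe_counit_ker θ θ₀ hqp, hs])
      rw [← hst, (TensorOver.rmap_exact hιq hq).apply_apply_eq_zero]
    · intro n
      obtain ⟨n, rfl⟩ := hp n
      obtain ⟨t, rfl⟩ := hc₀.2 n
      exact ⟨TensorOver.rmap R M q t, θ.counit_rmap θ₀ hqp t⟩
    · rintro (_ | i)
      · exact (P.torVanish_zero_iff hL₀ (Submodule.injective_subtype _) hιq hq).2 hι
      · exact (P.torVanish_succ_iff hL₀ (Submodule.injective_subtype _) hιq hq i).2 (htor' i)

/-- A projective resolution of `L = Hom_B(M, N)` that remains exact under `- ⊗_A M` yields a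
resolution of `N ≅ L ⊗_A M` in `add M`. -/
theorem addRes_of_projRes (hE : IsFullEnd A Bᵐᵒᵖ M) (hM : IsRProj R M) (P : ModuleResolution A M)
    (k : ℕ) :
    ∀ {L N : Type u} [AddCommGroup L] [Module R L] [Module Aᵐᵒᵖ L] [IsScalarTower R Aᵐᵒᵖ L]
      [AddCommGroup N] [Module R N] [Module Bᵐᵒᵖ N] [IsScalarTower R Bᵐᵒᵖ N]
      (θ : BalancedPairing R A B M L N), Function.Bijective θ.toHom →
      Function.Bijective θ.counit → (∀ i, P.TorVanish R L i) → IsRProj R N →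
      ProjRes R A k L → AddRes R Bᵐᵒᵖ M k N := by
  induction k with
  | zero =>
    intro L N _ _ _ _ _ _ _ _ θ _ hc _ _ hL
    exact θ.inAdd_of_counit_bijective hc hL
  | succ k ih =>
    rintro L N _ _ _ _ _ _ _ _ θ hθ hc htor hN ⟨Q, q, hQ, hq, hres⟩
    let N₀ : AlgMod R Bᵐᵒᵖ := tensorMod B M Q
    let θ₀ : BalancedPairing R A B M Q N₀ := tensorPairing Q
    have hθ₀ : Function.Bijective θ₀.toHom := tensorPairing_bijective hE Q hQ
    have hc₀ : Function.Bijective θ₀.counit :=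
      ⟨fun s t hst => ((counit_tensorPairing Q s).symm.trans hst).trans (counit_tensorPairing Q t),
        fun t => ⟨t, counit_tensorPairing Q t⟩⟩
    have hN₀ : InAdd Bᵐᵒᵖ M N₀ := θ₀.inAdd_of_counit_bijective hc₀ hQ
    let p : N₀ →ₗ[Bᵐᵒᵖ] N :=
      { toFun t := θ.counit (TensorOver.rmap R M q t)
        map_add' := map_add (θ.counit ∘ₗ TensorOver.rmap R M q)
        map_smul' b t := by
          change θ.counit (TensorOver.rmap R M q (tensorMap R A Q (rightMul A M b) t)) =
            b • θ.counit (TensorOver.rmap R M q t)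
          induction t using TensorOver.induction_on with
          | h0 => simp
          | h1 l m => exact map_smul (θ.toHom (q l)) b m
          | h2 s t hs ht => simp only [map_add, hs, ht, smul_add] }
    have hqp : ∀ l m, θ.toHom (q l) m = p (θ₀.toHom l m) := fun l m => rfl
    have hp : Function.Surjective p := hc.2.comp (TensorOver.rmap_surjective hq)
    have hsp : IsSplitOver R p := hN.isSplitOver hp
    have hιq := LinearMap.exact_subtype_ker_map q
    have hι := (P.torVanish_zero_iff hQ (Submodule.injective_subtype _) hιq hq).1 (htor 0)
    refine ⟨N₀, p, hN₀, hp, hsp, fun g => ?_, ih (θ.ker θ₀ hqp)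
      (θ.ker_toHom_bijective θ₀ hqp hθ₀ hθ.1) ⟨?_, ?_⟩ (fun i =>
        (P.torVanish_succ_iff hQ (Submodule.injective_subtype _) hιq hq i).1 (htor (i + 1)))
      ((hN₀.isRProj hM).ker hsp) hres⟩
    · obtain ⟨l, rfl⟩ := hθ.2 g
      obtain ⟨l, rfl⟩ := hq l
      exact ⟨θ₀.toHom l, LinearMap.ext fun m => (hqp l m).symm⟩
    · intro s t hst
      refine hι (hc₀.1 ?_)
      rw [← coe_counit_ker θ θ₀ hqp, ← coe_counit_ker θ θ₀ hqp, hst]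
    · rintro ⟨x, hx⟩
      obtain ⟨t, rfl⟩ := hc₀.2 x
      have h0 : TensorOver.rmap R M q t = 0 := hc.1 (by
        rw [θ.counit_rmap θ₀ hqp, map_zero]
        exact hx)
      obtain ⟨s, rfl⟩ := (TensorOver.rmap_exact hιq hq t).1 h0
      exact ⟨s, Subtype.ext (coe_counit_ker θ θ₀ hqp s)⟩

end BalancedPairing

end Bimodule

/-! ### The double centralizer property -/

section Centralizer

variable (R : Type u) [CommRing R] (A : Type u) [Ring A] [Algebra R A] (B : Type u) [Ring B]
  [Algebra R B] (M : Type u) [AddCommGroup M] [Module R M] [Module A M] [IsScalarTower R A M]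
  [Module Bᵐᵒᵖ M] [IsScalarTower R Bᵐᵒᵖ M] [SMulCommClass A Bᵐᵒᵖ M]

/-- The pairing `(M ⊗_B D M) × A → R`, `(m ⊗ f, a) ↦ f(a m)`. -/
def leftTrace : TensorOver R B M (StdDual R M) →ₗ[R] A →ₗ[R] R :=
  TensorOver.lift
    (fun m f =>
      { toFun a := f (a • m)
        map_add' a a' := by rw [add_smul, map_add]
        map_smul' r a := by rw [smul_assoc, map_smul]; rfl })
    (fun m m' f => LinearMap.ext fun a => (congrArg f (smul_add a m m')).trans (map_add f _ _))
    (fun m f f' => LinearMap.ext fun a => rfl)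
    (fun r m f => LinearMap.ext fun a => (congrArg f (smul_comm a r m)).trans (map_smul f _ _))
    (fun b m f => LinearMap.ext fun a => congrArg f (smul_comm a (op b) m))

variable {R A B M}

@[simp] theorem leftTrace_tmul (m : M) (f : StdDual R M) (a : A) :
    leftTrace R A B M (TensorOver.tmul R B m f) a = f (a • m) := rfl

variable (R A B M) in
/-- The pairing `(D M ⊗_A M) × B → R`, `(f ⊗ m, b) ↦ f(m b)`. -/
def rightPairing : BalancedPairing R A B M (StdDual R M) (StdDual R B) where
  toHom :=
    { toFun f :=
        { toFun m := StdDual.of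
            { toFun b := f (op b • m)
              map_add' b b' := by rw [MulOpposite.op_add, add_smul, map_add]
              map_smul' r b := by rw [op_smul, smul_assoc, map_smul]; rfl }
          map_add' m m' := StdDual.ext fun b =>
            (congrArg f (smul_add (op b) m m')).trans (map_add f _ _)
          map_smul' c m := StdDual.ext fun b => by
            induction c with | _ c => exact congrArg f (mul_smul (op b) (op c) m).symm }
      map_add' _ _ := rfl
      map_smul' _ _ := rfl }
  balanced a f m := StdDual.ext fun b => congrArg f (smul_comm a (op b) m)

/-- `Hom_B(M, D B) = D M`. -/
theorem rightPairing_toHom_bijective :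
    Function.Bijective (rightPairing R A B M).toHom := by
  constructor
  · intro f g h
    refine StdDual.ext fun m => ?_
    have := DFunLike.congr_fun (LinearMap.congr_fun h m) (1 : B)
    change f (op 1 • m) = g (op 1 • m) at this
    rwa [op_one, one_smul] at this
  · intro h
    refine ⟨StdDual.of
      { toFun m := h m 1
        map_add' m m' := by rw [map_add, StdDual.add_apply]
        map_smul' r m := by rw [LinearMap.map_smul_of_tower]; rfl },
      LinearMap.ext fun m => StdDual.ext fun b => ?_⟩
    change h (op b • m) 1 = h m b
    rw [map_smul, op_smul_apply, smul_eq_mul, mul_one]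

variable (R A B M) in
/-- `rightPairing` as a bilinear form. -/
def rightTrace : TensorOver R A (StdDual R M) M →ₗ[R] B →ₗ[R] R :=
  (rightPairing R A B M).counit

@[simp] theorem rightTrace_tmul (m : M) (f : StdDual R M) (b : B) :
    rightTrace R A B M (TensorOver.tmul R A f m) b = f (op b • m) := rfl

/-- `D(M ⊗_B D M) = End_B(M)`. -/
theorem flip_leftTrace_bijective_iff (hM : IsRProj R M) :
    Function.Bijective (leftTrace R A B M).flip ↔ IsFullEnd A Bᵐᵒᵖ M := by
  constructor
  · intro h
    refine ⟨fun a ha => h.1 (TensorOver.hom_ext fun m f => ?_), fun g => ?_⟩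
    · simp [ha]
    · obtain ⟨a, ha⟩ := h.2 (TensorOver.lift (fun m f => f (g m))
        (fun m m' f => by rw [map_add, map_add]) (fun m f f' => rfl)
        (fun r m f => by rw [LinearMap.map_smul_of_tower, map_smul])
        (fun b m f => by rw [map_smul]; rfl))
      refine ⟨a, fun m => StdDual.eq_of_forall hM fun f => ?_⟩
      exact LinearMap.congr_fun ha (TensorOver.tmul R B m f)
  · intro h
    constructor
    · rw [injective_iff_map_eq_zero]
      intro a ha
      refine h.faithful a fun m => StdDual.eq_of_forall hM fun f => ?_
      rw [map_zero]
      exact LinearMap.congr_fun ha (TensorOver.tmul R B m f)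
    · intro l
      choose g hg using fun m => StdDual.exists_eval hM
        (F := { toFun f := l (TensorOver.tmul R B m f)
                map_add' f f' := by rw [TensorOver.tmul_add, map_add]
                map_smul' r f := by
                  rw [RingHom.id_apply, ← map_smul, ← TensorOver.base_smul_tmul,
                    ← algebraMap_smul B r f, ← TensorOver.op_smul_tmul]
                  congr 2
                  exact algebraMap_smul Bᵐᵒᵖ r m })
      have hg' : ∀ m f, f (g m) = l (TensorOver.tmul R B m f) := fun m f => (hg m f).symm
      obtain ⟨a, ha⟩ := h.full
        { toFun := g
          map_add' m m' := StdDual.eq_of_forall hM fun f => by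
            rw [map_add, hg', hg', hg', TensorOver.add_tmul, map_add]
          map_smul' b m := StdDual.eq_of_forall hM fun f => by
            induction b with
            | _ b =>
              rw [hg', TensorOver.op_smul_tmul, ← hg']
              rfl }
      refine ⟨a, TensorOver.hom_ext fun m f => ?_⟩
      rw [← hg']
      exact congrArg f (ha m)

/-- `D(D M ⊗_A M) = End_A(M)`. -/
theorem flip_rightTrace_bijective_iff (hM : IsRProj R M) :
    Function.Bijective (rightTrace R A B M).flip ↔ IsFullEnd Bᵐᵒᵖ A M := by
  constructor
  · intro h
    refine ⟨fun b hb => ?_, fun g => ?_⟩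
    · induction b with
      | _ b =>
        have : b = 0 := h.1 (TensorOver.hom_ext fun f m => by simp [hb])
        rw [this, op_zero]
    · obtain ⟨b, hb⟩ := h.2 (TensorOver.lift (fun f m => f (g m))
        (fun f f' m => rfl) (fun f m m' => by rw [map_add, map_add])
        (fun r f m => rfl)
        (fun a f m => by rw [map_smul]; rfl))
      refine ⟨op b, fun m => StdDual.eq_of_forall hM fun f => ?_⟩
      exact LinearMap.congr_fun hb (TensorOver.tmul R A f m)
  · intro h
    constructor
    · rw [injective_iff_map_eq_zero]
      intro b hb
      refine op_injective (h.faithful (op b) fun m => StdDual.eq_of_forall hM fun f => ?_)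
      rw [map_zero]
      exact LinearMap.congr_fun hb (TensorOver.tmul R A f m)
    · intro l
      choose g hg using fun m => StdDual.exists_eval hM
        (F := { toFun f := l (TensorOver.tmul R A f m)
                map_add' f f' := by rw [TensorOver.add_tmul, map_add]
                map_smul' r f := by
                  rw [RingHom.id_apply, ← map_smul, ← TensorOver.base_smul_tmul] })
      have hg' : ∀ m f, f (g m) = l (TensorOver.tmul R A f m) := fun m f => (hg m f).symm
      obtain ⟨b, hb⟩ := h.full
        { toFun := g
          map_add' m m' := StdDual.eq_of_forall hM fun f => by
            rw [map_add, hg', hg', hg', TensorOver.tmul_add, map_add]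
          map_smul' a m := StdDual.eq_of_forall hM fun f => by
            rw [hg', ← TensorOver.op_smul_tmul, ← hg']
            rfl }
      refine ⟨unop b, TensorOver.hom_ext fun f m => ?_⟩
      rw [← hg']
      exact congrArg f (hb m)

end Centralizer

section PerfPair

variable {R : Type u} [CommRing R] {T E : Type u} [AddCommGroup T] [Module R T] [AddCommGroup E]
  [Module R E]

/-- A pairing that identifies `E` with `D T` identifies `T` with `D E`, since `T` is reflexive. -/
theorem bijective_of_flip_bijective (hT : IsRProj R T) (p : T →ₗ[R] E →ₗ[R] R)
    (h : Function.Bijective p.flip) : Function.Bijective p := by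
  obtain ⟨_, _⟩ := hT
  exact (LinearMap.IsPerfPair.of_bijective p.flip h).bijective_right

theorem flip_bijective_of_bijective (hE : IsRProj R E) (p : T →ₗ[R] E →ₗ[R] R)
    (h : Function.Bijective p) : Function.Bijective p.flip := by
  obtain ⟨_, _⟩ := hE
  exact (LinearMap.IsPerfPair.of_bijective p h).bijective_right

theorem isRProj_of_bijective (hE : IsRProj R E) (p : T →ₗ[R] E →ₗ[R] R)
    (h : Function.Bijective p) : IsRProj R T :=
  IsRProj.of_equiv (X := E →ₗ[R] R) hE.stdDual (LinearEquiv.ofBijective p h).symm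

end PerfPair

/-! ### Dominant dimension -/

section Split

variable {R : Type u} [CommRing R]

/-- Every map between the duals is a transpose, if the target is reflexive. -/
theorem exists_transpose {X Y : Type u} [AddCommGroup X] [Module R X] [AddCommGroup Y] [Module R Y]
    (hX : IsRProj R X) (σ : StdDual R X →ₗ[R] StdDual R Y) :
    ∃ s : Y →ₗ[R] X, ∀ (f : StdDual R X) (y : Y), f (s y) = σ f y := by
  choose s hs using fun y => StdDual.exists_eval hX
    (F := { toFun f := σ f y
            map_add' f f' := by rw [map_add, StdDual.add_apply]
            map_smul' r f := by rw [map_smul]; rfl })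
  have hs' : ∀ (f : StdDual R X) (y : Y), f (s y) = σ f y := fun f y => (hs y f).symm
  exact ⟨{ toFun := s
           map_add' y y' := StdDual.eq_of_forall hX fun f => by
             rw [map_add, hs', hs', hs', map_add]
           map_smul' r y := StdDual.eq_of_forall hX fun f => by
             rw [map_smul, hs', hs', map_smul, RingHom.id_apply] }, hs'⟩

variable {C : Type u} [Ring C] [Algebra R C] {X Y Z : Type u}
  [AddCommGroup X] [Module R X] [Module C X] [IsScalarTower R C X]
  [AddCommGroup Y] [Module R Y] [Module C Y] [IsScalarTower R C Y]
  [AddCommGroup Z] [Module R Z] [Module C Z] [IsScalarTower R C Z]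

/-- A map whose transpose is surjective splits. -/
theorem isSplitOver_of_transpose_surjective (hX : IsRProj R X) (d : X →ₗ[C] Y)
    (hd : Function.Surjective (transposeLeft (R := R) d)) : IsSplitOver R d := by
  obtain ⟨σ, hσ⟩ := hX.stdDual.exists_section ((transposeLeft d).restrictScalars R) hd
  obtain ⟨s, hs⟩ := exists_transpose hX σ
  refine ⟨s, fun x => congrArg d (StdDual.eq_of_forall hX fun f => ?_)⟩
  rw [hs]
  exact DFunLike.congr_fun (hσ f) x

/-- If the dual of `X → Y → Z` is right exact, then `Y → Z` splits. -/
theorem isSplitOver_of_transpose_exact (hX : IsRProj R X) (hY : IsRProj R Y) (hZ : IsRProj R Z)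
    (d : X →ₗ[C] Y) (e : Y →ₗ[C] Z) (hed : ∀ x, e (d x) = 0)
    (hd : Function.Surjective (transposeLeft (R := R) d))
    (he : ∀ g, transposeLeft (R := R) d g = 0 → ∃ h, transposeLeft (R := R) e h = g) :
    IsSplitOver R e := by
  have hsp := hX.stdDual.isSplitOver (C := Cᵐᵒᵖ) hd
  obtain ⟨r, hr⟩ := hsp.exists_retraction
  have hK := hY.stdDual.ker hsp
  let e' : StdDual R Z →ₗ[Cᵐᵒᵖ] LinearMap.ker (transposeLeft (R := R) d) :=
    (transposeLeft e).codRestrict _ fun h => StdDual.ext fun x => by simp [hed]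
  obtain ⟨τ, hτ⟩ := hK.exists_section (e'.restrictScalars R) fun ⟨g, hg⟩ => by
    obtain ⟨h, hh⟩ := he g hg
    exact ⟨h, Subtype.ext hh⟩
  obtain ⟨s, hs⟩ := exists_transpose hY (τ ∘ₗ r)
  refine ⟨s, fun y => StdDual.eq_of_forall hZ fun f => ?_⟩
  have h1 : f (e (s (e y))) = τ (r (transposeLeft e f)) (e y) := hs (transposeLeft e f) (e y)
  have h2 : r (transposeLeft e f) = e' f := hr (e' f)
  rw [h1, h2]
  exact DFunLike.congr_fun (congrArg Subtype.val (hτ (e' f))) y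

end Split

section DomDim

variable {R : Type u} [CommRing R] {B : Type u} [Ring B] [Algebra R B]
  {M : Type u} [AddCommGroup M] [Module R M] [Module Bᵐᵒᵖ M] [IsScalarTower R Bᵐᵒᵖ M]

/-- A map out of a quotient of `F`. -/
theorem exists_factor {C F X : Type u} [Ring C] [AddCommGroup F] [Module C F] [AddCommGroup X]
    [Module C X] {Y : Type u} [AddCommGroup Y] [Module C Y] {π : F →ₗ[C] X}
    (hπ : Function.Surjective π) (ρ : F →ₗ[C] Y) (h : ∀ x, π x = 0 → ρ x = 0) :
    ∃ g : X →ₗ[C] Y, ∀ x, g (π x) = ρ x := by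
  refine ⟨(LinearMap.ker π).liftQ ρ h ∘ₗ (π.quotKerEquivOfSurjective hπ).symm.toLinearMap,
    fun x => ?_⟩
  have : (π.quotKerEquivOfSurjective hπ).symm (π x) = Submodule.Quotient.mk x := by
    rw [LinearEquiv.symm_apply_eq]
    rfl
  exact congrArg ((LinearMap.ker π).liftQ ρ h) this

/-- The pairing `((b_j)_j ⊗ f) ↦ (x ↦ ∑_j f(x_j b_j))`. -/
def freeTrace (R B M : Type u) [CommRing R] [Ring B] [Algebra R B] [AddCommGroup M] [Module R M]
    [Module Bᵐᵒᵖ M] [IsScalarTower R Bᵐᵒᵖ M] (k : ℕ) :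
    TensorOver R B (Fin k → Bᵐᵒᵖ) (StdDual R M) →ₗ[R] StdDual R (Fin k → M) :=
  TensorOver.lift
    (fun b f => StdDual.of
      { toFun x := ∑ j, f (b j • x j)
        map_add' x y := by simp [Finset.sum_add_distrib]
        map_smul' r x := by
          simp only [Pi.smul_apply, smul_comm _ r, map_smul, RingHom.id_apply, Finset.smul_sum] })
    (fun b b' f => StdDual.ext fun x => by simp [add_smul, Finset.sum_add_distrib])
    (fun b f f' => StdDual.ext fun x => by simp [Finset.sum_add_distrib])
    (fun r b f => StdDual.ext fun x => by simp [Finset.mul_sum])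
    (fun c b f => StdDual.ext fun x => by simp [smul_apply, mul_smul])

theorem freeTrace_tmul (k : ℕ) (b : Fin k → Bᵐᵒᵖ) (f : StdDual R M) (x : Fin k → M) :
    freeTrace R B M k (TensorOver.tmul R B b f) x = ∑ j, f (b j • x j) := rfl

theorem freeTrace_surjective (k : ℕ) : Function.Surjective (freeTrace R B M k) := fun g => by
  refine ⟨∑ j, TensorOver.tmul R B (Pi.single j 1)
    (StdDual.of (g.toLin ∘ₗ LinearMap.single R (fun _ => M) j)), StdDual.ext fun x => ?_⟩
  rw [map_sum, StdDual.sum_apply]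
  conv_rhs => rw [← Finset.univ_sum_single x, StdDual.map_sum']
  refine Finset.sum_congr rfl fun j _ => ?_
  rw [freeTrace_tmul, Finset.sum_eq_single j]
  · simp
  · intro i _ hij
    rw [Pi.single_eq_of_ne hij, zero_smul, map_zero]
  · simp

/-- Multiplication by a matrix over `Bᵐᵒᵖ`, as a map of left `A`-modules `M^k → M^l`. -/
def matrixMap (A : Type u) [Ring A] {B M : Type u} [Ring B] [AddCommGroup M] [Module A M]
    [Module Bᵐᵒᵖ M] [SMulCommClass A Bᵐᵒᵖ M] {k l : ℕ} (c : Fin l → Fin k → Bᵐᵒᵖ) :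
    (Fin k → M) →ₗ[A] (Fin l → M) where
  toFun x i := ∑ j, c i j • x j
  map_add' x y := funext fun i => by simp [Finset.sum_add_distrib]
  map_smul' a x := funext fun i => by
    simp only [Pi.smul_apply, Finset.smul_sum, RingHom.id_apply, smul_comm a]

variable {A : Type u} [Ring A] [Algebra R A] [Module A M] [IsScalarTower R A M]
  [SMulCommClass A Bᵐᵒᵖ M]

/-- If the actions of `A` and `B` on `M` are each other's full endomorphism rings and
`D A ≅ M ⊗_B D M`, then dualizing a free presentation of `M` over `B` shows that the dominant
dimension of `A` relative to `M` is at least two. -/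
theorem domDimGE_two [IsNoetherianRing R] (hA : IsProjNoethAlg R A) (hB : IsProjNoethAlg R B)
    (hM : IsRProj R M) (hE : IsFullEnd A Bᵐᵒᵖ M) (hE' : IsFullEnd Bᵐᵒᵖ A M)
    (hα : Function.Bijective (leftTrace R A B M)) : DomDimGE R A M A 2 := by
  have := hM.1
  have hBop : IsRProj R Bᵐᵒᵖ := IsRProj.of_equiv hB (opLinearEquiv R)
  have := hBop.1
  have : Module.Finite Bᵐᵒᵖ M := Module.Finite.of_restrictScalars_finite R _ _
  obtain ⟨k, π, hπ⟩ := Module.Finite.exists_fin' Bᵐᵒᵖ M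
  have : Module.Finite R (LinearMap.ker π) :=
    inferInstanceAs (Module.Finite R ((LinearMap.ker π).restrictScalars R))
  have : Module.Finite Bᵐᵒᵖ (LinearMap.ker π) := Module.Finite.of_restrictScalars_finite R _ _
  obtain ⟨l, c', hc'⟩ := Module.Finite.exists_fin' Bᵐᵒᵖ (LinearMap.ker π)
  -- `Bˡ → Bᵏ → M → 0` is exact
  let c : (Fin l → Bᵐᵒᵖ) →ₗ[Bᵐᵒᵖ] (Fin k → Bᵐᵒᵖ) := (LinearMap.ker π).subtype ∘ₗ c'
  have hcπ : Function.Exact c π := fun x => by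
    constructor
    · intro hx
      obtain ⟨y, hy⟩ := hc' ⟨x, hx⟩
      exact ⟨y, congrArg Subtype.val hy⟩
    · rintro ⟨y, rfl⟩
      exact (c' y).2
  let m : Fin k → M := fun j => π (Pi.single j 1)
  have hm : ∀ b, π b = ∑ j, b j • m j := fun b => by
    conv_lhs => rw [← Finset.univ_sum_single b, map_sum]
    refine Finset.sum_congr rfl fun j _ => ?_
    rw [← map_smul, ← Pi.single_smul', smul_eq_mul, mul_one]
  let w : Fin l → Fin k → Bᵐᵒᵖ := fun i => c (Pi.single i 1)
  have hw : ∀ b j, c b j = ∑ i, b i * w i j := fun b j => by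
    conv_lhs => rw [← Finset.univ_sum_single b, map_sum, Finset.sum_apply]
    refine Finset.sum_congr rfl fun i _ => ?_
    rw [← smul_eq_mul, ← Pi.smul_apply, ← map_smul, ← Pi.single_smul', smul_eq_mul, mul_one]
  let d₀ : A →ₗ[A] (Fin k → M) := LinearMap.pi fun j => LinearMap.toSpanSingleton A M (m j)
  let d₁ : (Fin k → M) →ₗ[A] (Fin l → M) := matrixMap A w
  have hd₀ : ∀ a j, d₀ a j = a • m j := fun a j => rfl
  have hd₁ : ∀ x i, d₁ x i = ∑ j, w i j • x j := fun x i => rfl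
  have hd₁' : ∀ x (b : Fin l → Bᵐᵒᵖ), ∑ i, b i • d₁ x i = ∑ j, c b j • x j := fun x b => by
    simp only [hd₁, hw, Finset.smul_sum, Finset.sum_smul, mul_smul]
    exact Finset.sum_comm
  have hdd : ∀ a, d₁ (d₀ a) = 0 := fun a => funext fun i => by
    have : π (w i) = 0 := hcπ.apply_apply_eq_zero _
    simp only [hd₁, hd₀, ← smul_comm a, ← Finset.smul_sum, ← hm, this, smul_zero, Pi.zero_apply]
  have hker : ∀ x, d₁ x = 0 → ∃ a, d₀ a = x := fun x hx => by
    obtain ⟨g, hg⟩ := exists_factor hπ (Fintype.linearCombination Bᵐᵒᵖ x) fun b hb => by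
      obtain ⟨b, rfl⟩ := (hcπ b).1 hb
      rw [Fintype.linearCombination_apply, ← hd₁', hx]
      simp
    obtain ⟨a, ha⟩ := hE.full g
    refine ⟨a, funext fun j => ?_⟩
    rw [hd₀, ha, hg]
    simp
  have hinj : Function.Injective d₀ := by
    rw [injective_iff_map_eq_zero]
    intro a ha
    refine hE.faithful a fun x => ?_
    obtain ⟨b, rfl⟩ := hπ x
    rw [hm, Finset.smul_sum]
    refine Finset.sum_eq_zero fun j _ => ?_
    rw [smul_comm, ← hd₀, ha, Pi.zero_apply, smul_zero]
  -- the dual of `A → Mᵏ → Mˡ` is obtained from `Bˡ → Bᵏ → M → 0` by applying `- ⊗_B D M`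
  have ht₀ : ∀ u, transposeLeft d₀ (freeTrace R B M k u) =
      StdDual.of (leftTrace R A B M (TensorOver.rmap R _ π u)) := fun u => by
    have : (transposeLeft d₀).restrictScalars R ∘ₗ freeTrace R B M k =
        leftTrace R A B M ∘ₗ TensorOver.rmap R _ π := TensorOver.hom_ext fun b f => by
      refine StdDual.ext fun a => ?_
      change ∑ j, f (b j • d₀ a j) = f (a • π b)
      rw [← StdDual.map_sum', hm, Finset.smul_sum]
      simp only [hd₀, smul_comm a]
    exact LinearMap.congr_fun this u
  have ht₁ : ∀ u, transposeLeft d₁ (freeTrace R B M l u) =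
      freeTrace R B M k (TensorOver.rmap R _ c u) := fun u => by
    have : (transposeLeft d₁).restrictScalars R ∘ₗ freeTrace R B M l =
        freeTrace R B M k ∘ₗ TensorOver.rmap R _ c := TensorOver.hom_ext fun b f => by
      refine StdDual.ext fun x => ?_
      change ∑ i, f (b i • d₁ x i) = ∑ j, f (c b j • x j)
      rw [← StdDual.map_sum', ← StdDual.map_sum', hd₁']
    exact LinearMap.congr_fun this u
  have hsurj : Function.Surjective (transposeLeft (R := R) d₀) := fun φ => by
    obtain ⟨t, ht⟩ := hα.2 φ.toLin
    obtain ⟨u, rfl⟩ := TensorOver.rmap_surjective hπ t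
    exact ⟨freeTrace R B M k u, by rw [ht₀, ht]; rfl⟩
  have hex : ∀ g, transposeLeft (R := R) d₀ g = 0 → ∃ h, transposeLeft (R := R) d₁ h = g := by
    intro g hg
    obtain ⟨u, rfl⟩ := freeTrace_surjective (B := B) k g
    rw [ht₀] at hg
    have h0 : TensorOver.rmap R (StdDual R M) π u = 0 := hα.1 (hg.trans (map_zero _).symm)
    obtain ⟨v, rfl⟩ := (TensorOver.rmap_exact hcπ hπ u).1 h0
    exact ⟨_, ht₁ v⟩
  refine ⟨fun | 0 => ⟨A⟩ | 1 => ⟨Fin k → M⟩ | _ + 2 => ⟨Fin l → M⟩,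
    fun | 0 => d₀ | 1 => d₁ | _ + 2 => 0, ⟨LinearEquiv.refl A A⟩, ?_, fun _ => hinj, ?_, ?_,
    fun _ => ?_, ?_⟩
  · rintro (_ | _ | i) h1 h2
    · omega
    · exact InAdd.pi k
    · exact InAdd.pi l
  · rintro (_ | i) hi
    · exact fun x => ⟨hker x, by rintro ⟨a, rfl⟩; exact hdd a⟩
    · omega
  · rintro (_ | _ | i) hi
    · exact isSplitOver_of_transpose_surjective hA d₀ hsurj
    · exact isSplitOver_of_transpose_exact hA (hM.pi k) (hM.pi l) d₀ d₁ hdd hsurj hex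
    · omega
  · intro g
    obtain ⟨b, hb⟩ := hπ (g 1)
    refine ⟨LinearMap.lsum A (fun _ => M) ℕ fun j => rightMul A M (b j), LinearMap.ext_ring ?_⟩
    rw [← hb, hm]
    change LinearMap.lsum A (fun _ => M) ℕ _ (d₀ 1) = _
    simp [hd₀, rightMul]
  · rintro (_ | i) hi
    · intro g
      constructor
      · intro hg
        choose b hb using fun j => hE'.full (g ∘ₗ LinearMap.single A (fun _ => M) j)
        have hg' : ∀ x, g x = ∑ j, b j • x j := fun x => by
          conv_lhs => rw [← Finset.univ_sum_single x, map_sum]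
          exact Finset.sum_congr rfl fun j _ => (hb j (x j)).symm
        have hπb : π b = 0 := by
          have h1 : g (d₀ 1) = 0 := LinearMap.congr_fun hg 1
          simpa only [hg', hd₀, one_smul, ← hm] using h1
        obtain ⟨b', rfl⟩ := (hcπ b).1 hπb
        refine ⟨LinearMap.lsum A (fun _ => M) ℕ fun j => rightMul A M (b' j),
          LinearMap.ext fun x => ?_⟩
        rw [hg', ← hd₁']
        change LinearMap.lsum A (fun _ => M) ℕ _ (d₁ x) = _
        simp [rightMul]
      · rintro ⟨g, rfl⟩
        exact LinearMap.ext fun a => (congrArg g (hdd a)).trans (map_zero g)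
    · omega

/-- If the dominant dimension of `A` relative to `M` is at least two and `B` is the opposite
endomorphism ring of `M` over `A`, then `M ⊗_B D M ≅ D A`. -/
theorem leftTrace_bijective (hE' : IsFullEnd Bᵐᵒᵖ A M) (h : DomDimGE R A M A 2) :
    Function.Bijective (leftTrace R A B M) := by
  obtain ⟨X, d, ⟨e⟩, hadd, hinj, hex, hsplit, hsurj, -⟩ := h
  replace hinj := hinj (by omega)
  replace hex := hex 0 (by omega)
  obtain ⟨s₀, hs₀⟩ := hsplit 0 (by omega)
  obtain ⟨s₁, hs₁⟩ := hsplit 1 (by omega)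
  replace hsurj := hsurj (by omega)
  obtain ⟨k, i, p, hpi⟩ := inAdd_iff.1 (hadd 1 (by omega) (by omega))
  obtain ⟨l, i', p', hpi'⟩ := inAdd_iff.1 (hadd 2 (by omega) (by omega))
  let x₀ : X 1 := d 0 (e.symm 1)
  have hx₀ : ∀ a : A, d 0 (e.symm a) = a • x₀ := fun a => by
    rw [← map_smul, ← map_smul, smul_eq_mul, mul_one]
  let γ : StdDual R (X 1) →+ TensorOver R B M (StdDual R M) :=
    AddMonoidHom.mk' (fun g => ∑ j, TensorOver.tmul R B (i j x₀) (transposeLeft (p j) g))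
      fun g g' => by simp only [map_add, TensorOver.tmul_add, Finset.sum_add_distrib]
  have hγ_apply : ∀ g, γ g = ∑ j, TensorOver.tmul R B (i j x₀) (transposeLeft (p j) g) :=
    fun g => rfl
  have hγ : ∀ g a, leftTrace R A B M (γ g) a = g (d 0 (e.symm a)) := fun g a => by
    rw [hγ_apply, map_sum, LinearMap.sum_apply]
    simp only [leftTrace_tmul, transposeLeft_apply]
    rw [← StdDual.map_sum', hx₀]
    simp only [← map_smul, hpi]
  -- an endomorphism of `M` may be moved across the tensor sign
  have move : ∀ (x : M) (u : M →ₗ[A] M) (f : StdDual R M),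
      TensorOver.tmul R B x (transposeLeft u f) = TensorOver.tmul R B (u x) f := fun x u f => by
    obtain ⟨b, hb⟩ := hE'.full u
    rw [← hb, ← op_unop b, TensorOver.op_smul_tmul]
    congr 1
    exact StdDual.ext fun m => congrArg f (hb m).symm
  have hγ0 : ∀ g : StdDual R (X 1), (∀ a, g (d 0 (e.symm a)) = 0) → γ g = 0 := by
    intro g hg
    -- `g` factors through `d 1`
    have hfac : ∀ x, g x = g (s₁ (d 1 x)) := fun x => by
      obtain ⟨y, hy⟩ := (hex (x - s₁ (d 1 x))).1 (by rw [map_sub, hs₁, sub_self])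
      have := hg (e y)
      rw [e.symm_apply_apply, hy, map_sub, sub_eq_zero] at this
      exact this
    let g' : StdDual R (X 2) := StdDual.of (g.toLin ∘ₗ s₁)
    have hg' : ∀ j, transposeLeft (p j) g =
        ∑ n, transposeLeft (i' n ∘ₗ d 1 ∘ₗ p j) (transposeLeft (p' n) g') := fun j =>
      StdDual.ext fun m => by
        rw [StdDual.sum_apply]
        simp only [transposeLeft_apply, LinearMap.comp_apply]
        rw [← StdDual.map_sum', hpi']
        exact hfac _
    rw [hγ_apply]
    simp only [hg', TensorOver.tmul_sum, move]
    rw [Finset.sum_comm]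
    refine Finset.sum_eq_zero fun n _ => ?_
    rw [← TensorOver.sum_tmul]
    simp only [LinearMap.comp_apply]
    rw [← map_sum, ← map_sum, hpi, show d 1 x₀ = 0 from hex.apply_apply_eq_zero _, map_zero,
      TensorOver.zero_tmul]
  have hγsurj : ∀ t, ∃ g, γ g = t := fun t => by
    induction t using TensorOver.induction_on with
    | h0 => exact ⟨0, map_zero _⟩
    | h1 m f =>
      obtain ⟨h, hh⟩ := hsurj (LinearMap.toSpanSingleton A M m ∘ₗ e.toLinearMap)
      have hh1 : h x₀ = m :=
        (LinearMap.congr_fun hh (e.symm 1)).trans (by simp)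
      refine ⟨transposeLeft h f, ?_⟩
      have hcomp : ∀ j, transposeLeft (p j) (transposeLeft (R := R) h f) =
          transposeLeft (h ∘ₗ p j) f := fun j => rfl
      rw [hγ_apply]
      simp only [hcomp, move]
      rw [← TensorOver.sum_tmul]
      simp only [LinearMap.comp_apply]
      rw [← map_sum, hpi, hh1]
    | h2 s t hs ht =>
      obtain ⟨g, rfl⟩ := hs
      obtain ⟨g', rfl⟩ := ht
      exact ⟨g + g', map_add _ _ _⟩
  constructor
  · rw [injective_iff_map_eq_zero]
    intro t ht
    obtain ⟨g, rfl⟩ := hγsurj t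
    exact hγ0 g fun a => by rw [← hγ, ht, LinearMap.zero_apply]
  · intro φ
    refine ⟨γ (StdDual.of (φ ∘ₗ (e.restrictScalars R).toLinearMap ∘ₗ s₀)),
      LinearMap.ext fun a => ?_⟩
    rw [hγ]
    change φ (e (s₀ (d 0 (e.symm a)))) = φ a
    rw [hinj (hs₀ (e.symm a)), e.apply_symm_apply]

end DomDim

/-! ### The correspondence between the two classes of pairs -/

section Correspondence

variable {R : Type u} [CommRing R] {A : Type u} [Ring A] [Algebra R A] {B : Type u} [Ring B]
  [Algebra R B] {M : Type u} [AddCommGroup M] [Module R M] [Module A M] [IsScalarTower R A M]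
  [Module Bᵐᵒᵖ M] [IsScalarTower R Bᵐᵒᵖ M] [SMulCommClass A Bᵐᵒᵖ M]

/-- Under the double centralizer property, `D B ≅ D M ⊗_A M` and `Tor^A_i(D M, M) = 0` for `i > 0`,
relative injective resolutions of `M` over `A` correspond to resolutions of `D B` in `add_B M`. -/
theorem relInjDimLE_iff_hasAddResolution (hA : IsProjNoethAlg R A) (hB : IsProjNoethAlg R B)
    (hM : IsRProj R M) (hE : IsFullEnd A Bᵐᵒᵖ M) (P : ModuleResolution A M)
    (hβ : Function.Bijective (rightPairing R A B M).counit)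
    (htor : ∀ i, P.TorVanish R (StdDual R M) i) (k : ℕ) :
    RelInjDimLE R A M k ↔ HasAddResolution R Bᵐᵒᵖ M (StdDual R B) k := by
  rw [relInjDimLE_iff hA hM, hasAddResolution_iff]
  exact ⟨(rightPairing R A B M).addRes_of_projRes hE hM P k rightPairing_toHom_bijective hβ htor
      hB.stdDual,
    fun h => ((rightPairing R A B M).projRes_of_addRes hE P k rightPairing_toHom_bijective h).1⟩

theorem relInjDimEq_iff_isLeast (hA : IsProjNoethAlg R A) (hB : IsProjNoethAlg R B)
    (hM : IsRProj R M) (hE : IsFullEnd A Bᵐᵒᵖ M) (P : ModuleResolution A M)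
    (hβ : Function.Bijective (rightPairing R A B M).counit)
    (htor : ∀ i, P.TorVanish R (StdDual R M) i) (n : ℕ) :
    RelInjDimEq R A M n ↔ IsLeast {k | HasAddResolution R Bᵐᵒᵖ M (StdDual R B) k} n := by
  have : {k | RelInjDimLE R A M k} = {k | HasAddResolution R Bᵐᵒᵖ M (StdDual R B) k} :=
    Set.ext (relInjDimLE_iff_hasAddResolution hA hB hM hE P hβ htor)
  rw [RelInjDimEq, this]

/-- If `M` is a quasi-cogenerator over `B` and `A = End_B(M)`, then `B` is the opposite endomorphism
ring of `M` over `A`, and `(A, M)` satisfies the conditions of `DomClass`. -/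
theorem IsQuasiCogenerator.dominant [IsNoetherianRing R] {n : ℕ} (hB : IsProjNoethAlg R B)
    (h : IsQuasiCogenerator R B M n) (hE : IsFullEnd A Bᵐᵒᵖ M) :
    IsFullEnd Bᵐᵒᵖ A M ∧ IsProjNoethAlg R A ∧ Module.Finite A M ∧ Module.Projective R M ∧
      DomDimGE R A M A 2 ∧ RelInjDimEq R A M n ∧
      IsRProj R (TensorOver R A (StdDual R M) M) ∧
      ∀ i : ℕ, 0 < i → Limits.IsZero (TorOver R A (StdDual R M) i M) := by
  obtain ⟨hfin, hproj, hT, hres⟩ := h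
  have hBop : IsRProj R Bᵐᵒᵖ := IsRProj.of_equiv hB (opLinearEquiv R)
  have := hBop.1
  have hM : IsRProj R M := ⟨Module.Finite.trans Bᵐᵒᵖ M, hproj⟩
  have := hM.1
  have hα' := (flip_leftTrace_bijective_iff hM).2 hE
  have hα := bijective_of_flip_bijective hT _ hα'
  have hA : IsProjNoethAlg R A := isRProj_of_bijective hT _ hα'
  let P := ProjectiveResolution.of (ModuleCat.of A M)
  obtain ⟨-, hβ, htor⟩ := (rightPairing R A B M).projRes_of_addRes hE
    (.ofProjectiveResolution P) n rightPairing_toHom_bijective (hasAddResolution_iff.1 hres.1)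
  have hE' := (flip_rightTrace_bijective_iff hM).1
    (flip_bijective_of_bijective hB (rightTrace R A B M) hβ)
  refine ⟨hE', hA, Module.Finite.of_restrictScalars_finite R A M, hproj,
    domDimGE_two hA hB hM hE hE' hα,
    (relInjDimEq_iff_isLeast hA hB hM hE (.ofProjectiveResolution P) hβ htor n).2 hres,
    isRProj_of_bijective hB (rightTrace R A B M) hβ, ?_⟩
  rintro (_ | i) hi
  · exact absurd hi (lt_irrefl 0)
  · exact (ModuleResolution.isZero_torOver_iff P i).2 (htor i)

/-- If `(A, M)` satisfies the conditions of `DomClass` and `B` is the opposite endomorphism ring of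
`M` over `A`, then `A = End_B(M)`, and `M` is a quasi-cogenerator over `B`. -/
theorem isQuasiCogenerator_of_dominant {n : ℕ} (hA : IsProjNoethAlg R A) (hfin : Module.Finite A M)
    (hproj : Module.Projective R M) (hdom : DomDimGE R A M A 2) (hinj : RelInjDimEq R A M n)
    (hT : IsRProj R (TensorOver R A (StdDual R M) M))
    (htor : ∀ i : ℕ, 0 < i → Limits.IsZero (TorOver R A (StdDual R M) i M))
    (hE' : IsFullEnd Bᵐᵒᵖ A M) :
    IsFullEnd A Bᵐᵒᵖ M ∧ IsProjNoethAlg R B ∧ IsQuasiCogenerator R B M n := by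
  have := hA.1
  have hM : IsRProj R M := ⟨Module.Finite.trans A M, hproj⟩
  have := hM.1
  have hβ' := (flip_rightTrace_bijective_iff hM).2 hE'
  have hβ := bijective_of_flip_bijective hT _ hβ'
  have hB : IsProjNoethAlg R B := isRProj_of_bijective hT _ hβ'
  have hα := leftTrace_bijective hE' hdom
  have hE := (flip_leftTrace_bijective_iff hM).1 (flip_bijective_of_bijective hA _ hα)
  let P := ProjectiveResolution.of (ModuleCat.of A M)
  refine ⟨hE, hB, Module.Finite.of_restrictScalars_finite R _ _, hproj,
    isRProj_of_bijective hA _ hα,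
    (relInjDimEq_iff_isLeast hA hB hM hE (.ofProjectiveResolution P) hβ
      (fun i => (ModuleResolution.isZero_torOver_iff P i).1 (htor (i + 1) i.succ_pos)) n).1 hinj⟩

/-- A full action of `A` identifies `A` with the endomorphism ring. -/
noncomputable def IsFullEnd.algEquiv (hE : IsFullEnd A Bᵐᵒᵖ M) : A ≃ₐ[R] Module.End Bᵐᵒᵖ M :=
  AlgEquiv.ofBijective
    { toFun a :=
        { toFun m := a • m
          map_add' := smul_add a
          map_smul' b m := smul_comm a b m }
      map_one' := LinearMap.ext fun m => one_smul A m
      map_mul' a a' := LinearMap.ext fun m => mul_smul a a' m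
      map_zero' := LinearMap.ext fun m => zero_smul A m
      map_add' a a' := LinearMap.ext fun m => add_smul a a' m
      commutes' r := LinearMap.ext fun m => algebraMap_smul A r m }
    ⟨fun a a' h => hE.eq_of_smul fun m => LinearMap.congr_fun h m, fun f => by
      obtain ⟨a, ha⟩ := hE.full f
      exact ⟨a, LinearMap.ext ha⟩⟩

/-- A full right action of `B` identifies `B` with the opposite endomorphism ring. -/
noncomputable def IsFullEnd.algEquivOp (hE : IsFullEnd Bᵐᵒᵖ A M) : B ≃ₐ[R] (Module.End A M)ᵐᵒᵖ :=
  AlgEquiv.ofBijective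
    { toFun b := op (rightMul A M (op b))
      map_one' := unop_injective (LinearMap.ext fun m => one_smul Bᵐᵒᵖ m)
      map_mul' b b' := unop_injective (LinearMap.ext fun m => mul_smul (op b') (op b) m)
      map_zero' := unop_injective (LinearMap.ext fun m => zero_smul Bᵐᵒᵖ m)
      map_add' b b' := unop_injective (LinearMap.ext fun m => add_smul (op b) (op b') m)
      commutes' r := unop_injective (LinearMap.ext fun m => algebraMap_smul Bᵐᵒᵖ r m) }
    ⟨fun b b' h => op_injective (hE.eq_of_smul fun m =>
      LinearMap.congr_fun (congrArg unop h) m), fun f => by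
      obtain ⟨b, hb⟩ := hE.full (unop f)
      exact ⟨unop b, unop_injective (LinearMap.ext hb)⟩⟩

end Correspondence

section Pairs

variable {R : Type u} [CommRing R]

/-- Conjugation by a semilinear isomorphism. -/
def endConj {S S' M M' : Type u} [Ring S] [Algebra R S] [Ring S'] [Algebra R S'] [AddCommGroup M]
    [Module R M] [Module S M] [IsScalarTower R S M] [AddCommGroup M'] [Module R M'] [Module S' M']
    [IsScalarTower R S' M'] (σ : S ≃ S') (φ : M ≃ₗ[R] M')
    (h : ∀ s m, φ (s • m) = σ s • φ m) : Module.End S M ≃ₐ[R] Module.End S' M' where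
  toFun f :=
    { toFun m := φ (f (φ.symm m))
      map_add' m m' := by simp only [map_add]
      map_smul' s m := by
        have : φ.symm (s • m) = σ.symm s • φ.symm m := φ.injective (by simp [h])
        rw [this, map_smul, h, σ.apply_symm_apply, RingHom.id_apply] }
  invFun f :=
    { toFun m := φ.symm (f (φ m))
      map_add' m m' := by simp only [map_add]
      map_smul' s m := φ.injective (by simp [h]) }
  left_inv f := LinearMap.ext fun m => by simp
  right_inv f := LinearMap.ext fun m => by simp
  map_mul' f g := LinearMap.ext fun m => by simp
  map_add' f g := LinearMap.ext fun m => by simp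
  commutes' r := LinearMap.ext fun m => by simp [Module.algebraMap_end_apply]

theorem RightPair.Iso.endo {P P' : RightPair R} (h : P.Iso P') : P.endo.Iso P'.endo := by
  obtain ⟨σ, φ, h⟩ := h
  refine ⟨endConj (opEquiv.symm.trans (σ.toEquiv.trans opEquiv)) φ fun b m => ?_, φ, fun f m => ?_⟩
  · exact h (unop b) m
  · exact congrArg (fun x => φ ((show Module.End P.algᵐᵒᵖ P.mod from f) x))
      (φ.symm_apply_apply m).symm

theorem LeftPair.Iso.endoOp {Q Q' : LeftPair R} (h : Q.Iso Q') : Q.endoOp.Iso Q'.endoOp := by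
  obtain ⟨σ, φ, h⟩ := h
  refine ⟨(endConj σ.toEquiv φ h).op, φ, fun f m => ?_⟩
  exact congrArg (fun x => φ (unop f x)) (φ.symm_apply_apply m).symm

theorem isFullEnd_endo (S M : Type u) [Ring S] [AddCommGroup M] [Module S M] :
    IsFullEnd (Module.End S M) S M :=
  ⟨fun _ h => LinearMap.ext h, fun f => ⟨f, fun _ => rfl⟩⟩

variable [IsNoetherianRing R] {n : ℕ}

/-- Passing to the endomorphism ring twice gives back the pair. -/
theorem RightPair.endo_spec {P : RightPair R} (hP : P ∈ CogenClass R n) :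
    P.endo ∈ DomClass R n ∧ P.endo.endoOp.Iso P := by
  obtain ⟨hE', h⟩ := hP.2.dominant (A := Module.End P.algᵐᵒᵖ P.mod) hP.1 (isFullEnd_endo _ _)
  let σ : P.alg ≃ₐ[R] (Module.End (Module.End P.algᵐᵒᵖ P.mod) P.mod)ᵐᵒᵖ := hE'.algEquivOp
  refine ⟨h, RightPair.iso_equivalence.symm ⟨σ, LinearEquiv.refl R _, ?_⟩⟩
  intro b m
  rfl

omit [IsNoetherianRing R] in
/-- Passing to the endomorphism ring twice gives back the pair. -/
theorem LeftPair.endoOp_spec {Q : LeftPair R} (hQ : Q ∈ DomClass R n) :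
    Q.endoOp ∈ CogenClass R n ∧ Q.endoOp.endo.Iso Q := by
  obtain ⟨h1, h2, h3, h4, h5, h6, h7⟩ := hQ
  let _ := opOpModule (Module.End Q.alg Q.mod) Q.mod
  have : IsScalarTower R (Module.End Q.alg Q.mod)ᵐᵒᵖᵐᵒᵖ Q.mod := ⟨fun _ _ _ => rfl⟩
  have : SMulCommClass Q.alg (Module.End Q.alg Q.mod)ᵐᵒᵖᵐᵒᵖ Q.mod :=
    ⟨fun a f m => (map_smul (unop (unop f)) a m).symm⟩
  obtain ⟨hE, h⟩ := isQuasiCogenerator_of_dominant (B := (Module.End Q.alg Q.mod)ᵐᵒᵖ)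
    h1 h2 h3 h4 h5 h6 h7 ⟨fun f hf => unop_injective (unop_injective (LinearMap.ext hf)),
      fun f => ⟨op (op f), fun _ => rfl⟩⟩
  let σ : Q.alg ≃ₐ[R] Module.End (Module.End Q.alg Q.mod)ᵐᵒᵖᵐᵒᵖ Q.mod := hE.algEquiv
  refine ⟨h, LeftPair.iso_equivalence.symm ⟨σ, LinearEquiv.refl R _, ?_⟩⟩
  intro a m
  rfl

end Pairs

end HigherMorita

theorem theorem3p4 (R : Type u) [CommRing R] [IsNoetherianRing R] (n : ℕ) :
    ∃ (hΦ : ∀ P : HigherMorita.RightPair R,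
          P ∈ HigherMorita.CogenClass R n → P.endo ∈ HigherMorita.DomClass R n)
      (hΨ : ∀ Q : HigherMorita.LeftPair R,
          Q ∈ HigherMorita.DomClass R n → Q.endoOp ∈ HigherMorita.CogenClass R n)
      (e : Quotient (HigherMorita.cogenSetoid R n) ≃ Quotient (HigherMorita.domSetoid R n)),
      (∀ P : HigherMorita.CogenClass R n,
        e (Quotient.mk _ P) = Quotient.mk _ ⟨P.1.endo, hΦ P.1 P.2⟩) ∧
      (∀ Q : HigherMorita.DomClass R n,
        e.symm (Quotient.mk _ Q) = Quotient.mk _ ⟨Q.1.endoOp, hΨ Q.1 Q.2⟩) := by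
  have hΦ := fun P (hP : P ∈ HigherMorita.CogenClass R n) => (HigherMorita.RightPair.endo_spec hP).1
  have hΨ := fun Q (hQ : Q ∈ HigherMorita.DomClass R n) => (HigherMorita.LeftPair.endoOp_spec hQ).1
  refine ⟨hΦ, hΨ,
    { toFun := Quotient.lift (fun P => Quotient.mk _ ⟨P.1.endo, hΦ P.1 P.2⟩)
        fun P P' h => Quotient.sound (HigherMorita.RightPair.Iso.endo h)
      invFun := Quotient.lift (fun Q => Quotient.mk _ ⟨Q.1.endoOp, hΨ Q.1 Q.2⟩)
        fun Q Q' h => Quotient.sound (HigherMorita.LeftPair.Iso.endoOp h)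
      left_inv := ?_
      right_inv := ?_ }, fun _ => rfl, fun _ => rfl⟩
  · rintro ⟨P⟩
    exact Quotient.sound (HigherMorita.RightPair.endo_spec P.2).2
  · rintro ⟨Q⟩
    exact Quotient.sound (HigherMorita.LeftPair.endoOp_spec Q.2).2
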